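/- **Setting.** Let $(\mathbf M,\otimes,I,\tau)$ be a closed symmetric monoidal category (with small hom-sets) that is complete and cocomplete. An *orthogonal category* $\overline{\mathbf C}=(\mathbf C,\perp)$ is a category $\mathbf C$ together with a set $\perp$ of pairs $(f_1:c_1\to c,\ f_2:c_2\to c)$ of morphisms with common target that is symmetric and stable under composition: $f_1\perp f_2$ implies $f_2\perp f_1$, $gf_1\perp gf_2$ and $f_1h_1\perp f_2h_2$ for all composable $g,h_1,h_2$. An *orthogonal functor* $F:\overline{\mathbf C}\to\overline{\mathbf D}$ is a functor with $F(f_1)\perp_{\mathbf D}F(f_2)$ whenever $f_1\perp_{\mathbf C}f_2$. It is an *orthogonal equivalence* if $F$ is an equivalence of categories and $F^*(\perp_{\mathbf D})=\perp_{\mathbf C}$, where $F^*(\perp_{\mathbf D})=\{(f_1,f_2): F(f_1)\perp_{\mathbf D}F(f_2)\}$. For a small orthogonal category $\overline{\mathbf C}$, let $\mathcal O_{\overline{\mathbf C}}$ be the operad in $\mathbf M$, colored by the objects of $\mathbf C$, with objects of operations the copowers $$\mathcal O_{\overline{\mathbf C}}\tbinom{t}{c_1,\dots,c_n}=\Big(\Sigma_n\times\prod_{i=1}^n\mathbf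 C(c_i,t)\Big)\Big/{\sim_\perp}\ \otimes I .$$ Here $(\sigma,f)\sim_\perp(\sigma',f')$ if and only if $f=f'$ and $\sigma\sigma'^{-1}:f\sigma^{-1}\to f\sigma'^{-1}$ is a finite product of transpositions of adjacent orthogonal pairs. The action of right permutations is $[\sigma,f]\mapsto[\sigma\sigma',f\sigma']$, the units are $[e,\mathrm{id}_t]$, and composition is $[\sigma,f]\otimes\bigotimes_i[\sigma_i,g_i]\mapsto[\sigma(\sigma_1,\dots,\sigma_m),f(g_1,\dots,g_m)]$, with $\sigma(\sigma_1,\dots,\sigma_m)$ the block composition of permutations and $f(g_1,\dots,g_m)$ the sequence of all composites $f_ig_{ij}$. An orthogonal functor $F:\overline{\mathbf C}\to\overline{\mathbf D}$ between small orthogonal categories induces an operad morphism $\mathcal O_F:[\sigma,f]\mapsto[\sigma,F(f)]$, hence a pullback functor $\mathcal O_F^*:\mathbf{Alg}(\mathcal O_{\overline{\mathbf D}})\to\mathbf{Alg}(\mathcal O_{\overline{\mathbf C}})$ between the categories of ($\mathbf M$-valued) algebras, the categories of quantum field theories on $\overline{\mathbf D}$ and $\overline{\mathbf C}$. Write ${\mathcal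 O_F}_!$ for its left adjoint, which is unique up to unique isomorphism. **Theorem.** 1. Let $F:\overline{\mathbf C}\to\overline{\mathbf D}$ be an orthogonal equivalence between small orthogonal categories. Then $\mathcal O_F^*$ has a left adjoint, and every adjunction $${\mathcal O_F}_!:\mathbf{Alg}(\mathcal O_{\overline{\mathbf C}})\rightleftarrows\mathbf{Alg}(\mathcal O_{\overline{\mathbf D}}):\mathcal O_F^*$$ is an adjoint equivalence, i.e. its unit and counit are natural isomorphisms. In other words, $\mathcal O_F$ is a Morita equivalence. 2. In particular, the category of quantum field theories does not depend on the chosen small model: let $\overline{\mathbf E}$ be a (possibly large) orthogonal category and let $I:\overline{\mathbf C}\to\overline{\mathbf E}$ and $J:\overline{\mathbf D}\to\overline{\mathbf E}$ be orthogonal equivalences with $\overline{\mathbf C}$ and $\overline{\mathbf D}$ small. Then there is an orthogonal equivalence $G:\overline{\mathbf C}\to\overline{\mathbf D}$ with $J\circ G\cong I$ for which $\mathcal O_G^*:\mathbf{Alg}(\mathcal O_{\overline{\mathbf D}})\to\mathbf{Alg}(\mathcal O_{\overline{\mathbf C}})$ is an equivalence of categories. -/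

import Mathlib

open CategoryTheory MonoidalCategory Limits

namespace OrthQFT

universe w v u

set_option linter.unusedSectionVars false
set_option linter.unusedVariables false

/-! ### Concatenation of finite blocks -/

/-- The total length of consecutive blocks of lengths `k 0, …, k (m - 1)`. -/
def total : {m : ℕ} → (Fin m → ℕ) → ℕ
  | 0, _ => 0
  | m + 1, k => total (fun i : Fin m => k i.castSucc) + k (Fin.last m)

/-- The position of the `j`-th entry of the `i`-th block in the concatenation of the blocks. -/
def pos : {m : ℕ} → (k : Fin m → ℕ) → (i : Fin m) → Fin (k i) → Fin (total k)
  | 0, _, i, _ => i.elim0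
  | m + 1, k, i, j =>
    Fin.lastCases (motive := fun i => Fin (k i) → Fin (total k))
      (fun j => Fin.natAdd (total fun i : Fin m => k i.castSucc) j)
      (fun i j => Fin.castAdd (k (Fin.last m)) (pos (fun i : Fin m => k i.castSucc) i j)) i j

/-- The block and the entry of that block found at a given position of the concatenation. -/
def locate : {m : ℕ} → (k : Fin m → ℕ) → Fin (total k) → (Σ i : Fin m, Fin (k i))
  | 0, _, p => p.elim0
  | m + 1, k, p =>
    Fin.addCases (motive := fun _ => Σ i : Fin (m + 1), Fin (k i))
      (fun p => ⟨(locate (fun i : Fin m => k i.castSucc) p).1.castSucc,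
        (locate (fun i : Fin m => k i.castSucc) p).2⟩)
      (fun j => ⟨Fin.last m, j⟩) p

theorem pos_last {m : ℕ} (k : Fin (m + 1) → ℕ) (j : Fin (k (Fin.last m))) :
    pos k (Fin.last m) j = Fin.natAdd (total fun i : Fin m => k i.castSucc) j :=
  congrFun (Fin.lastCases_last (motive := fun i => Fin (k i) → Fin (total k))) j

theorem pos_castSucc {m : ℕ} (k : Fin (m + 1) → ℕ) (i : Fin m) (j : Fin (k i.castSucc)) :
    pos k i.castSucc j =
      Fin.castAdd (k (Fin.last m)) (pos (fun i : Fin m => k i.castSucc) i j) :=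
  congrFun (Fin.lastCases_castSucc (motive := fun i => Fin (k i) → Fin (total k)) i) j

theorem val_pos_last {m : ℕ} (k : Fin (m + 1) → ℕ) (j : Fin (k (Fin.last m))) :
    (pos k (Fin.last m) j : ℕ) = (total fun i : Fin m => k i.castSucc) + j := by
  rw [pos_last]; rfl

theorem val_pos_castSucc {m : ℕ} (k : Fin (m + 1) → ℕ) (i : Fin m) (j : Fin (k i.castSucc)) :
    (pos k i.castSucc j : ℕ) = pos (fun i : Fin m => k i.castSucc) i j := by
  rw [pos_castSucc]; rfl

theorem locate_castAdd {m : ℕ} (k : Fin (m + 1) → ℕ)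
    (p : Fin (total fun i : Fin m => k i.castSucc)) :
    locate k (Fin.castAdd (k (Fin.last m)) p) =
      ⟨(locate (fun i : Fin m => k i.castSucc) p).1.castSucc,
        (locate (fun i : Fin m => k i.castSucc) p).2⟩ :=
  Fin.addCases_left (motive := fun _ => Σ i : Fin (m + 1), Fin (k i)) p

theorem locate_natAdd {m : ℕ} (k : Fin (m + 1) → ℕ) (j : Fin (k (Fin.last m))) :
    locate k (Fin.natAdd (total fun i : Fin m => k i.castSucc) j) = ⟨Fin.last m, j⟩ :=
  Fin.addCases_right (motive := fun _ => Σ i : Fin (m + 1), Fin (k i)) j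

theorem locate_pos : {m : ℕ} → (k : Fin m → ℕ) → (i : Fin m) → (j : Fin (k i)) →
    locate k (pos k i j) = ⟨i, j⟩
  | 0, _, i, _ => i.elim0
  | m + 1, k, i, j => by
    induction i using Fin.lastCases with
    | last => rw [pos_last, locate_natAdd]
    | cast i =>
      rw [pos_castSucc, locate_castAdd, locate_pos (fun i : Fin m => k i.castSucc) i j]

theorem pos_locate : {m : ℕ} → (k : Fin m → ℕ) → (p : Fin (total k)) →
    pos k (locate k p).1 (locate k p).2 = p
  | 0, _, p => p.elim0
  | m + 1, k, p => by
    refine Fin.addCases (motive := fun p => pos k (locate k p).1 (locate k p).2 = p)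
      (fun q => ?_) (fun j => ?_) p
    · rw [locate_castAdd, pos_castSucc, pos_locate (fun i : Fin m => k i.castSucc) q]
    · rw [locate_natAdd, pos_last]

/-- Entries of blocks correspond to positions in the concatenation (lexicographic order). -/
def blocks {m : ℕ} (k : Fin m → ℕ) : (Σ i : Fin m, Fin (k i)) ≃ Fin (total k) where
  toFun x := pos k x.1 x.2
  invFun := locate k
  left_inv x := locate_pos k x.1 x.2
  right_inv p := pos_locate k p

@[simp] theorem blocks_symm_apply {m : ℕ} (k : Fin m → ℕ) (p : Fin (total k)) :
    (blocks k).symm p = locate k p := rfl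

@[simp] theorem locate_blocks {m : ℕ} (k : Fin m → ℕ) (x : Σ i : Fin m, Fin (k i)) :
    locate k (blocks k x) = x := (blocks k).symm_apply_apply x

theorem pos_lt_pos : {m : ℕ} → (k : Fin m → ℕ) → (i i' : Fin m) → (j : Fin (k i)) →
    (j' : Fin (k i')) → ((pos k i j : ℕ) < pos k i' j' ↔
      (i : ℕ) < i' ∨ ((i : ℕ) = i' ∧ (j : ℕ) < j'))
  | 0, _, i, _, _, _ => i.elim0
  | m + 1, k, i, i', j, j' => by
    induction i using Fin.lastCases with
    | last =>
      induction i' using Fin.lastCases with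
      | last => rw [val_pos_last, val_pos_last]; omega
      | cast i' =>
        have h1 := (pos (fun i : Fin m => k i.castSucc) i' j').2
        have h2 := i'.2
        rw [val_pos_last, val_pos_castSucc, Fin.val_last, Fin.val_castSucc]
        omega
    | cast i =>
      induction i' using Fin.lastCases with
      | last =>
        have h1 := (pos (fun i : Fin m => k i.castSucc) i j).2
        have h2 := i.2
        rw [val_pos_last, val_pos_castSucc, Fin.val_last, Fin.val_castSucc]
        omega
      | cast i' =>
        rw [val_pos_castSucc, val_pos_castSucc, Fin.val_castSucc, Fin.val_castSucc]
        exact pos_lt_pos (fun i : Fin m => k i.castSucc) i i' j j'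

/-! ### Profiles -/

/-- A profile: a finite sequence of colors. -/
structure Profile (K : Type w) where
  /-- the length -/
  len : ℕ
  /-- the entries -/
  color : Fin len → K

namespace Profile

variable {K : Type w}

/-- A right permutation `c ⟶ c σ`, `(c σ)_i = c_{σ i}`. -/
@[ext] structure Hom (c d : Profile K) where
  /-- the permutation -/
  perm : Fin d.len ≃ Fin c.len
  color_eq : ∀ i, d.color i = c.color (perm i)

/-- The groupoid of profiles and right permutations. -/
instance : Category (Profile K) where
  Hom := Hom
  id c := ⟨Equiv.refl _, fun _ => rfl⟩
  comp f g := ⟨g.perm.trans f.perm, fun i => (g.color_eq i).trans (f.color_eq _)⟩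

@[simp] theorem id_perm (c : Profile K) : Hom.perm (𝟙 c) = Equiv.refl _ := rfl

@[simp] theorem comp_perm {c d e : Profile K} (f : c ⟶ d) (g : d ⟶ e) :
    Hom.perm (f ≫ g) = (Hom.perm g).trans (Hom.perm f) := rfl

theorem Hom.len_eq {c d : Profile K} (f : c ⟶ d) : d.len = c.len := by
  simpa using Fintype.card_congr (Hom.perm f)

/-- The profile with exactly one entry. -/
def single (t : K) : Profile K := ⟨1, fun _ => t⟩

/-- The profile `c σ = (c_{σ 1}, …, c_{σ n})`. -/
def reindex (c : Profile K) {n : ℕ} (σ : Fin n ≃ Fin c.len) : Profile K :=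
  ⟨n, fun i => c.color (σ i)⟩

/-- The morphism `σ : c ⟶ c σ`. -/
def reindexHom (c : Profile K) {n : ℕ} (σ : Fin n ≃ Fin c.len) : c ⟶ c.reindex σ :=
  Hom.mk (d := c.reindex σ) σ (fun _ => rfl)

/-- Entrywise application of a map of colors. -/
def map {L : Type*} (f : K → L) (c : Profile K) : Profile L := ⟨c.len, fun i => f (c.color i)⟩

/-- Entrywise application of a map of colors, on right permutations. -/
def mapHom {L : Type*} (f : K → L) {c d : Profile K} (h : Hom c d) :
    (c.map f ⟶ d.map f) :=
  Hom.mk (c := c.map f) (d := d.map f) h.perm (fun i => congrArg f (h.color_eq i))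

/-- The entry of a family of profiles at a pair of indices. -/
def entry {m : ℕ} (b : Fin m → Profile K) (x : Σ i : Fin m, Fin (b i).len) : K :=
  (b x.1).color x.2

/-- The concatenation `b_1 ⊗ ⋯ ⊗ b_m` of a finite family of profiles. -/
def concat {m : ℕ} (b : Fin m → Profile K) : Profile K :=
  ⟨total fun i => (b i).len, fun p => entry b (locate (fun i => (b i).len) p)⟩

/-- Right permutations from a bijection between the pairs of indices. -/
def concatHom {m m' : ℕ} (b : Fin m → Profile K) (b' : Fin m' → Profile K)
    (e : (Σ i, Fin (b' i).len) ≃ Σ i, Fin (b i).len) (h : ∀ x, entry b' x = entry b (e x)) :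
    concat b ⟶ concat b' :=
  Hom.mk (c := concat b) (d := concat b') ((blocks _).symm.trans (e.trans (blocks _)))
    (fun p => (h (locate _ p)).trans
      (congrArg (entry b) (locate_blocks _ (e (locate _ p))).symm))

/-- The block permutation `σ⟨k_1, …, k_m⟩ : b_1 ⊗ ⋯ ⊗ b_m ⟶ b_{σ 1} ⊗ ⋯ ⊗ b_{σ m}`. -/
def blockPerm {m n : ℕ} (b : Fin m → Profile K) (σ : Fin n ≃ Fin m) :
    concat b ⟶ concat (fun j => b (σ j)) :=
  concatHom b (fun j => b (σ j))
    (Equiv.sigmaCongrLeft (β := fun i => Fin (b i).len) σ) (fun _ => rfl)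

/-- The block sum `σ_1 ⊕ ⋯ ⊕ σ_m`. -/
def blockSum {m : ℕ} {b b' : Fin m → Profile K} (σ : ∀ i, b i ⟶ b' i) : concat b ⟶ concat b' :=
  concatHom b b' (Equiv.sigmaCongrRight fun i => Hom.perm (σ i))
    (fun x => Hom.color_eq (σ x.1) x.2)

/-- The identification `a = a_1 ⊗ ⋯ ⊗ a_m` of a profile with the concatenation of its entries. -/
def concatSingle (a : Profile K) : a ⟶ concat (fun i => single (a.color i)) :=
  Hom.mk (c := a) (d := concat fun i => single (a.color i))
    ((blocks fun _ : Fin a.len => 1).symm.trans (Equiv.sigmaUnique (Fin a.len) fun _ => Fin 1))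
    (fun _ => rfl)

/-- The identification of a profile with the concatenation of a single block. -/
def concatOne (t : K) (a : Profile K) : a ⟶ concat (fun _ : Fin (single t).len => a) :=
  Hom.mk (c := a) (d := concat fun _ : Fin (single t).len => a)
    ((blocks fun _ : Fin 1 => a.len).symm.trans
      { toFun := fun x => x.2
        invFun := fun j => ⟨0, j⟩
        left_inv := fun x => by rw [Subsingleton.elim 0 x.1]
        right_inv := fun _ => rfl })
    (fun _ => rfl)

/-- A doubly indexed family of profiles, indexed by the positions of a concatenation. -/
def flat {m : ℕ} (b : Fin m → Profile K) (c : ∀ i, Fin (b i).len → Profile K) :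
    Fin (concat b).len → Profile K :=
  fun p => c (locate _ p).1 (locate _ p).2

/-- Entries of iterated concatenations correspond to triples of indices. -/
def tripleEquiv {m : ℕ} (b : Fin m → Profile K) (c : ∀ i, Fin (b i).len → Profile K) :
    (Σ i, Fin (concat (c i)).len) ≃ Σ x : Σ i, Fin (b i).len, Fin (c x.1 x.2).len :=
  (Equiv.sigmaCongrRight fun i => (blocks fun j => (c i j).len).symm).trans
    (Equiv.sigmaAssoc fun (i : Fin m) (j : Fin (b i).len) => Fin (c i j).len).symm

/-- Entries of flattened concatenations correspond to triples of indices. -/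
def flatEquiv {m : ℕ} (b : Fin m → Profile K) (c : ∀ i, Fin (b i).len → Profile K) :
    (Σ p, Fin (flat b c p).len) ≃ Σ x : Σ i, Fin (b i).len, Fin (c x.1 x.2).len :=
  Equiv.sigmaCongrLeft (β := fun x : Σ i, Fin (b i).len => Fin (c x.1 x.2).len)
    (blocks fun i => (b i).len).symm

/-- The identification `⊗_{(i,j)} c_{ij} = ⊗_i ⊗_j c_{ij}` of iterated concatenations. -/
def concatAssoc {m : ℕ} (b : Fin m → Profile K) (c : ∀ i, Fin (b i).len → Profile K) :
    concat (flat b c) ⟶ concat (fun i => concat (c i)) :=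
  concatHom (flat b c) (fun i => concat (c i)) ((tripleEquiv b c).trans (flatEquiv b c).symm)
    (fun x => congrArg (fun y : Σ x : Σ i, Fin (b i).len, Fin (c x.1 x.2).len =>
      (c y.1.1 y.1.2).color y.2) ((flatEquiv b c).apply_symm_apply (tripleEquiv b c x)).symm)

end Profile

/-! ### Orthogonal categories -/

/-- An orthogonality relation on a category: a set of pairs of morphisms with common target,
symmetric and stable under post- and pre-composition. -/
structure Orthogonality (C : Type u) [Category.{v} C] where
  /-- `Rel f₁ f₂` means that `f₁` and `f₂` are orthogonal -/
  Rel : ∀ ⦃c₁ c₂ c : C⦄, (c₁ ⟶ c) → (c₂ ⟶ c) → Prop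
  symm : ∀ ⦃c₁ c₂ c : C⦄ {f₁ : c₁ ⟶ c} {f₂ : c₂ ⟶ c}, Rel f₁ f₂ → Rel f₂ f₁
  postcomp : ∀ ⦃c₁ c₂ c d : C⦄ {f₁ : c₁ ⟶ c} {f₂ : c₂ ⟶ c} (g : c ⟶ d),
    Rel f₁ f₂ → Rel (f₁ ≫ g) (f₂ ≫ g)
  precomp : ∀ ⦃c₁ c₂ c b₁ b₂ : C⦄ {f₁ : c₁ ⟶ c} {f₂ : c₂ ⟶ c} (h₁ : b₁ ⟶ c₁) (h₂ : b₂ ⟶ c₂),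
    Rel f₁ f₂ → Rel (h₁ ≫ f₁) (h₂ ≫ f₂)

/-- The pullback `F^* (⊥)` of an orthogonality relation along a functor. -/
def Orthogonality.pullback {C : Type*} [Category C] {D : Type*} [Category D]
    (R : Orthogonality D) (F : C ⥤ D) : Orthogonality C where
  Rel _ _ _ f₁ f₂ := R.Rel (F.map f₁) (F.map f₂)
  symm _ _ _ _ _ h := R.symm h
  postcomp _ _ _ _ _ _ g h := by simpa using R.postcomp (F.map g) h
  precomp _ _ _ _ _ _ _ h₁ h₂ h := by simpa using R.precomp (F.map h₁) (F.map h₂) h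

/-- An orthogonal functor: a functor that preserves orthogonal pairs. -/
structure OrthFunctor {C : Type*} [Category C] {D : Type*} [Category D]
    (R : Orthogonality C) (S : Orthogonality D) where
  /-- the underlying functor -/
  functor : C ⥤ D
  map_rel : ∀ ⦃c₁ c₂ c : C⦄ {f₁ : c₁ ⟶ c} {f₂ : c₂ ⟶ c}, R.Rel f₁ f₂ →
    S.Rel (functor.map f₁) (functor.map f₂)

/-- An orthogonal equivalence: an orthogonal functor `F : (C, ⊥_C) → (D, ⊥_D)` that is an
equivalence of categories and satisfies `F^* (⊥_D) = ⊥_C`. -/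
structure OrthFunctor.IsOrthEquivalence {C : Type*} [Category C] {D : Type*} [Category D]
    {R : Orthogonality C} {S : Orthogonality D} (F : OrthFunctor R S) : Prop where
  isEquivalence : F.functor.IsEquivalence
  pullback_eq : S.pullback F.functor = R

/-! ### Colored operads in sets -/

open Profile in
/-- A `K`-colored (symmetric) operad with values in sets. -/
structure SetOperad (K : Type w) where
  /-- the operations with inputs `c` and output `t` -/
  obj : Profile K → K → Type v
  /-- the action of right permutations -/
  map : ∀ {c d : Profile K} {t : K}, (c ⟶ d) → obj c t → obj d t
  map_id : ∀ {c : Profile K} {t : K} (p : obj c t), map (𝟙 c) p = p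
  map_comp : ∀ {c d e : Profile K} {t : K} (g : c ⟶ d) (h : d ⟶ e) (p : obj c t),
    map (g ≫ h) p = map h (map g p)
  /-- the operadic units -/
  one : ∀ t : K, obj (single t) t
  /-- the operadic composition `γ` -/
  comp : ∀ {t : K} {a : Profile K} (b : Fin a.len → Profile K), obj a t →
    (∀ i, obj (b i) (a.color i)) → obj (concat b) t
  /-- first equivariance axiom -/
  comp_perm : ∀ {t : K} {a : Profile K} (b : Fin a.len → Profile K) (p : obj a t)
    (q : ∀ i, obj (b i) (a.color i)) {n : ℕ} (σ : Fin n ≃ Fin a.len),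
    comp (a := a.reindex σ) (fun j => b (σ j)) (map (a.reindexHom σ) p) (fun j => q (σ j)) =
      map (blockPerm b σ) (comp b p q)
  /-- second equivariance axiom -/
  comp_map : ∀ {t : K} {a : Profile K} (b b' : Fin a.len → Profile K) (p : obj a t)
    (q : ∀ i, obj (b i) (a.color i)) (σ : ∀ i, b i ⟶ b' i),
    comp b' p (fun i => map (σ i) (q i)) = map (blockSum σ) (comp b p q)
  /-- associativity -/
  assoc : ∀ {t : K} {a : Profile K} (b : Fin a.len → Profile K)
    (c : ∀ i, Fin (b i).len → Profile K) (p : obj a t) (q : ∀ i, obj (b i) (a.color i))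
    (r : ∀ i j, obj (c i j) ((b i).color j)),
    map (concatAssoc b c) (comp (a := concat b) (flat b c) (comp b p q)
      (fun x => r (locate _ x).1 (locate _ x).2)) =
      comp (fun i => concat (c i)) p (fun i => comp (c i) (q i) (r i))
  /-- unitality -/
  comp_one : ∀ {t : K} {a : Profile K} (p : obj a t),
    comp (fun i => single (a.color i)) p (fun i => one (a.color i)) = map (concatSingle a) p
  /-- unitality -/
  one_comp : ∀ {t : K} {a : Profile K} (p : obj a t),
    comp (a := single t) (fun _ => a) (one t) (fun _ => p) = map (concatOne t a) p

/-- A morphism of operads in sets with varying colors. -/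
structure SetOperad.Hom {K : Type*} {L : Type*} (P : SetOperad K) (Q : SetOperad L) where
  /-- the map of colors -/
  color : K → L
  /-- the action on operations -/
  app : ∀ {c : Profile K} {t : K}, P.obj c t → Q.obj (c.map color) (color t)
  app_map : ∀ {c d : Profile K} {t : K} (h : c ⟶ d) (p : P.obj c t),
    app (P.map h p) = Q.map (Profile.mapHom color h) (app p)
  app_one : ∀ t : K, app (P.one t) = Q.one (color t)
  app_comp : ∀ {t : K} {a : Profile K} (b : Fin a.len → Profile K) (p : P.obj a t)
    (q : ∀ i, P.obj (b i) (a.color i)),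
    app (P.comp b p q) =
      Q.comp (a := a.map color) (fun i => (b i).map color) (app p) (fun i => app (q i))

/-! ### The operad of a category and of an orthogonal category -/

theorem equiv_eq_of_lt_iff {n n' : ℕ} (e e' : Fin n ≃ Fin n')
    (h : ∀ i j, (e i : ℕ) < e j → (e' i : ℕ) < e' j) : e = e' := by
  have hm : StrictMono (e.symm.trans e') := fun i j hij =>
    Fin.lt_def.2 (h _ _ (by simpa using hij))
  have : (hm.orderIsoOfSurjective _ (e.symm.trans e').surjective) = OrderIso.refl _ :=
    Subsingleton.elim _ _
  ext i
  have h2 := congrArg (fun f : Fin n' ≃o Fin n' => f (e i)) this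
  have h3 : e' (e.symm (e i)) = e i := h2
  rw [Equiv.symm_apply_apply] at h3
  rw [h3]

theorem fin_one_not_lt (x y : Fin 1) : ¬ (x : ℕ) < y := by omega

theorem eqToHom_eqToHom_comp {C : Type*} [Category C] {X Y Z W : C} (h : X = Y) (h' : Y = Z)
    (h'' : X = Z) (f : Z ⟶ W) : eqToHom h ≫ eqToHom h' ≫ f = eqToHom h'' ≫ f := by
  subst h h'
  simp

theorem eqToHom_congr_arg {C : Type*} [Category C] {A : Type*} {W : C} (X : A → C)
    (H : ∀ a, X a ⟶ W) {a a' : A} (h : a = a') : H a = eqToHom (congrArg X h) ≫ H a' := by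
  subst h
  simp

/-- The permutation `σ(σ_1, …, σ_m) = σ⟨k_{σ⁻¹ 1}, …, k_{σ⁻¹ m}⟩ (σ_1 ⊕ ⋯ ⊕ σ_m)`: the `j`-th
entry of the `i`-th block is sent to the `σ_i j`-th entry of the block at position `σ i`. -/
def composePerm {m : ℕ} (k : Fin m → ℕ) (σ : Fin m ≃ Fin m) (τ : ∀ i, Fin (k i) ≃ Fin (k i)) :
    Fin (total k) ≃ Fin (total k) :=
  ((blocks k).symm.trans ((Equiv.sigmaCongr (β₂ := fun i => Fin (k (σ.symm i))) σ
    (fun i => (τ i).trans (finCongr (congrArg k (σ.symm_apply_apply i).symm)))).trans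
    (blocks fun i => k (σ.symm i)))).trans
    (finCongr (by
      simpa using Fintype.card_congr
        ((blocks fun i => k (σ.symm i)).symm.trans
          ((Equiv.sigmaCongrLeft (β := fun i => Fin (k i)) σ.symm).trans (blocks k)))))

theorem composePerm_lt {m : ℕ} (k : Fin m → ℕ) (σ : Fin m ≃ Fin m)
    (τ : ∀ i, Fin (k i) ≃ Fin (k i)) (p p' : Fin (total k)) :
    (composePerm k σ τ p : ℕ) < composePerm k σ τ p' ↔
      (σ (locate k p).1 : ℕ) < σ (locate k p').1 ∨ (σ (locate k p).1 : ℕ) = σ (locate k p').1 ∧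
        (τ _ (locate k p).2 : ℕ) < τ _ (locate k p').2 :=
  pos_lt_pos (fun i => k (σ.symm i)) _ _ _ _

section

variable (C : Type u) [Category.{v} C]

/-- The operations `Σ_n × ∏_i C(c_i, t)` of the operad of a category `C`. -/
@[ext] structure FreeOp (c : Profile C) (t : C) where
  /-- the permutation -/
  perm : Fin c.len ≃ Fin c.len
  /-- the morphisms -/
  hom : ∀ i, c.color i ⟶ t

variable {C}

namespace FreeOp

open Profile

/-- The action `(σ, f) ↦ (σ σ', f σ')` of right permutations. -/
def map {c d : Profile C} {t : C} (h : c ⟶ d) (p : FreeOp C c t) : FreeOp C d t where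
  perm := ((Hom.perm h).trans p.perm).trans (finCongr (Hom.len_eq h).symm)
  hom i := eqToHom (Hom.color_eq h i) ≫ p.hom (Hom.perm h i)

/-- The unit `(e, id)`. -/
def one (t : C) : FreeOp C (single t) t where
  perm := Equiv.refl _
  hom _ := 𝟙 t

/-- The composition `(σ, f) ⊗ (σ_i, g_i) ↦ (σ(σ_1, …, σ_m), f(g_1, …, g_m))`. -/
def comp {t : C} {a : Profile C} (b : Fin a.len → Profile C) (p : FreeOp C a t)
    (q : ∀ i, FreeOp C (b i) (a.color i)) : FreeOp C (concat b) t where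
  perm := composePerm _ p.perm (fun i => (q i).perm)
  hom x := (q (locate _ x).1).hom (locate _ x).2 ≫ p.hom (locate _ x).1

theorem comp_hom {t : C} {a : Profile C} (b : Fin a.len → Profile C) (p : FreeOp C a t)
    (q : ∀ i, FreeOp C (b i) (a.color i)) (x : Fin (concat b).len) (y : Σ i, Fin (b i).len)
    (h : locate _ x = y) : (comp b p q).hom x =
      eqToHom (congrArg (entry b) h) ≫ (q y.1).hom y.2 ≫ p.hom y.1 := by
  subst h
  exact (Category.id_comp _).symm

theorem comp_lt {t : C} {a : Profile C} (b : Fin a.len → Profile C) (p : FreeOp C a t)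
    (q : ∀ i, FreeOp C (b i) (a.color i)) (x x' : Fin (concat b).len)
    (y y' : Σ i, Fin (b i).len) (h : locate _ x = y) (h' : locate _ x' = y') :
    ((comp b p q).perm x : ℕ) < (comp b p q).perm x' ↔ (p.perm y.1 : ℕ) < p.perm y'.1 ∨
      (p.perm y.1 : ℕ) = p.perm y'.1 ∧ ((q _).perm y.2 : ℕ) < (q _).perm y'.2 := by
  subst h h'
  exact composePerm_lt _ _ _ _ _

theorem comp_eq {t : C} {a : Profile C} (b : Fin a.len → Profile C) (p : FreeOp C a t)
    (q : ∀ i, FreeOp C (b i) (a.color i)) (x x' : Fin (concat b).len)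
    (y y' : Σ i, Fin (b i).len) (h : locate _ x = y) (h' : locate _ x' = y') :
    ((comp b p q).perm x : ℕ) = (comp b p q).perm x' ↔ y = y' := by
  subst h h'
  rw [← Fin.ext_iff, (comp b p q).perm.injective.eq_iff]
  exact ((blocks _).symm.injective.eq_iff).symm

theorem ext' {c : Profile C} {t : C} {p q : FreeOp C c t}
    (h₁ : ∀ i j, (p.perm i : ℕ) < p.perm j → (q.perm i : ℕ) < q.perm j)
    (h₂ : ∀ i, p.hom i = q.hom i) : p = q :=
  FreeOp.ext (equiv_eq_of_lt_iff _ _ h₁) (funext h₂)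

theorem assoc_aux {t : C} {a : Profile C} (b : Fin a.len → Profile C)
    (c : ∀ i, Fin (b i).len → Profile C) (p : FreeOp C a t)
    (q : ∀ i, FreeOp C (b i) (a.color i)) (r : ∀ i j, FreeOp C (c i j) ((b i).color j))
    (y y' : Σ i, Fin (concat (c i)).len) (u u' : Σ x, Fin (flat b c x).len)
    (hu : flatEquiv b c u = tripleEquiv b c y) (hu' : flatEquiv b c u' = tripleEquiv b c y')
    (h : ((comp b p q).perm u.1 : ℕ) < (comp b p q).perm u'.1 ∨
      ((comp b p q).perm u.1 : ℕ) = (comp b p q).perm u'.1 ∧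
      ((r (locate _ u.1).1 (locate _ u.1).2).perm u.2 : ℕ) <
        (r (locate _ u'.1).1 (locate _ u'.1).2).perm u'.2) :
    (p.perm y.1 : ℕ) < p.perm y'.1 ∨ (p.perm y.1 : ℕ) = p.perm y'.1 ∧
      ((comp (c y.1) (q y.1) (r y.1)).perm y.2 : ℕ) <
        (comp (c y'.1) (q y'.1) (r y'.1)).perm y'.2 := by
  obtain ⟨i, z⟩ := y
  obtain ⟨i', z'⟩ := y'
  have h1 : locate _ u.1 = ⟨i, (locate _ z).1⟩ := congrArg Sigma.fst hu
  have h1' : locate _ u'.1 = ⟨i', (locate _ z').1⟩ := congrArg Sigma.fst hu'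
  have h2 : ((r (locate _ u.1).1 (locate _ u.1).2).perm u.2 : ℕ) =
      (r i (locate _ z).1).perm (locate _ z).2 :=
    congrArg (fun T : Σ x : Σ i, Fin (b i).len, Fin (c x.1 x.2).len =>
      ((r T.1.1 T.1.2).perm T.2 : ℕ)) hu
  have h2' : ((r (locate _ u'.1).1 (locate _ u'.1).2).perm u'.2 : ℕ) =
      (r i' (locate _ z').1).perm (locate _ z').2 :=
    congrArg (fun T : Σ x : Σ i, Fin (b i).len, Fin (c x.1 x.2).len =>
      ((r T.1.1 T.1.2).perm T.2 : ℕ)) hu'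
  rw [comp_lt b p q _ _ _ _ h1 h1', comp_eq b p q _ _ _ _ h1 h1', h2, h2'] at h
  rcases h with (h | ⟨h, h3⟩) | ⟨h, h3⟩
  · exact Or.inl h
  · obtain rfl : i = i' := p.perm.injective (Fin.ext h)
    exact Or.inr ⟨h, (comp_lt _ _ _ _ _ _ _ rfl rfl).2 (Or.inl h3)⟩
  · obtain rfl : i = i' := congrArg Sigma.fst h
    have h4 : (locate _ z).1 = (locate _ z').1 := eq_of_heq (Sigma.mk.inj h).2
    exact Or.inr ⟨rfl, (comp_lt _ _ _ _ _ _ _ rfl rfl).2 (Or.inr ⟨by rw [h4], h3⟩)⟩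

end FreeOp

/-- The operad `O_C` of a category. -/
def freeOperad (C : Type u) [Category.{v} C] : SetOperad.{u, v} C where
  obj c t := FreeOp C c t
  map h p := p.map h
  map_id p := FreeOp.ext' (fun _ _ h => h) (fun _ => Category.id_comp _)
  map_comp g h p := FreeOp.ext' (fun _ _ h => h) (fun i => by simp [FreeOp.map])
  one t := FreeOp.one t
  comp b p q := FreeOp.comp b p q
  comp_perm {t a} b p q n σ := by
    have key : ∀ x, locate _ (Profile.Hom.perm (Profile.blockPerm b σ) x) =
      ⟨σ (locate _ x).1, (locate _ x).2⟩ := fun x => locate_blocks _ _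
    refine FreeOp.ext' (fun i j h => ?_) (fun i => ?_)
    · exact (FreeOp.comp_lt b p q _ _ _ _ (key i) (key j)).2
        ((FreeOp.comp_lt (a := a.reindex σ) _ _ _ _ _ _ _ rfl rfl).1 h)
    · refine Eq.trans ?_ (congrArg (eqToHom _ ≫ ·) (FreeOp.comp_hom b p q _ _ (key i))).symm
      refine Eq.trans ?_ (eqToHom_eqToHom_comp _ _ rfl _).symm
      refine Eq.trans ?_ (Category.id_comp _).symm
      exact congrArg (_ ≫ ·) (Category.id_comp _)
  comp_map {t a} b b' p q σ := by
    have key : ∀ x, locate _ (Profile.Hom.perm (Profile.blockSum σ) x) =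
      ⟨(locate _ x).1, Profile.Hom.perm (σ _) (locate _ x).2⟩ := fun x => locate_blocks _ _
    refine FreeOp.ext' (fun i j h => ?_) (fun i => ?_)
    · exact (FreeOp.comp_lt b p q _ _ _ _ (key i) (key j)).2
        ((FreeOp.comp_lt b' _ _ _ _ _ _ rfl rfl).1 h)
    · refine Eq.trans ?_ (congrArg (eqToHom _ ≫ ·) (FreeOp.comp_hom b p q _ _ (key i))).symm
      refine Eq.trans ?_ (eqToHom_eqToHom_comp _ _ (Profile.Hom.color_eq (σ _) _) _).symm
      exact Category.assoc _ _ _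
  assoc {t a} b c p q r := by
    have key : ∀ x, locate _ (Profile.Hom.perm (Profile.concatAssoc b c) x) =
      (Profile.flatEquiv b c).symm (Profile.tripleEquiv b c (locate _ x)) :=
      fun x => locate_blocks _ _
    refine FreeOp.ext' (fun x x' h => ?_) (fun x => ?_)
    · refine (FreeOp.comp_lt _ _ _ _ _ _ _ rfl rfl).2 ?_
      exact FreeOp.assoc_aux b c p q r _ _ _ _ (Equiv.apply_symm_apply _ _)
        (Equiv.apply_symm_apply _ _)
        ((FreeOp.comp_lt (a := Profile.concat b) _ _ _ _ _ _ _ (key x) (key x')).1 h)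
    · refine (congrArg (eqToHom _ ≫ ·)
        (FreeOp.comp_hom (a := Profile.concat b) _ _ _ _ _ (key x))).trans ?_
      refine (eqToHom_eqToHom_comp _ _ (by
        rw [← key x]; exact Profile.Hom.color_eq (Profile.concatAssoc b c) x) _).trans ?_
      refine (congrArg (eqToHom _ ≫ ·) (eqToHom_congr_arg
        (fun T : Σ x : Σ i, Fin (b i).len, Fin (c x.1 x.2).len => (c T.1.1 T.1.2).color T.2)
        (fun T => (r T.1.1 T.1.2).hom T.2 ≫ (q T.1.1).hom T.1.2 ≫ p.hom T.1.1)
        ((Profile.flatEquiv b c).apply_symm_apply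
          (Profile.tripleEquiv b c (locate _ x))))).trans ?_
      refine (eqToHom_eqToHom_comp _ _ rfl _).trans ?_
      exact (Category.id_comp _).trans (Category.assoc _ _ _).symm
  comp_one {t a} p := by
    refine FreeOp.ext' (fun i j h => ?_) (fun i => ?_)
    · have h2 := (FreeOp.comp_lt _ _ _ _ _ _ _ rfl rfl).1 h
      rcases h2 with h2 | h2
      · exact h2
      · exact absurd h2.2 (fin_one_not_lt _ _)
    · refine (Category.id_comp _).trans (Category.id_comp _).symm
  one_comp {t a} p := by
    refine FreeOp.ext' (fun i j h => ?_) (fun i => ?_)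
    · have h2 := (FreeOp.comp_lt (a := Profile.single t) (fun _ => a) _ _ _ _ _ _ rfl rfl).1 h
      rcases h2 with h2 | h2
      · exact absurd h2 (fin_one_not_lt _ _)
      · exact h2.2
    · refine (Category.comp_id _).trans (Category.id_comp _).symm

end

section

variable {C : Type u} [Category.{v} C]

/-- One transposition `τ` of an adjacent orthogonal pair in the sequence `f σ⁻¹`: it replaces
`σ` by `τ⁻¹ σ`, hence `f σ⁻¹` by `f σ⁻¹ τ`. -/
def AdjacentSwap (R : Orthogonality C) {c : Profile C} {t : C} (f : ∀ i, c.color i ⟶ t)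
    (σ σ' : Fin c.len ≃ Fin c.len) : Prop :=
  ∃ p q : Fin c.len, (p : ℕ) + 1 = q ∧ R.Rel (f (σ.symm p)) (f (σ.symm q)) ∧
    σ' = σ.trans (Equiv.swap p q)

/-- The equivalence relation `∼_⊥`: the morphisms agree, and the right permutation
`σ σ'⁻¹ : f σ⁻¹ → f σ'⁻¹` is a finite product of transpositions of adjacent orthogonal pairs. -/
def FreeOp.Equivalent (R : Orthogonality C) {c : Profile C} {t : C} (p q : FreeOp C c t) : Prop :=
  p.hom = q.hom ∧ Relation.ReflTransGen (AdjacentSwap R p.hom) p.perm q.perm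

theorem swap_val {n : ℕ} (p q x : Fin n) : (Equiv.swap p q x : ℕ) =
    if (x : ℕ) = p then (q : ℕ) else if (x : ℕ) = q then (p : ℕ) else x := by
  rw [Equiv.swap_apply_def]
  simp only [Fin.ext_iff]
  split_ifs <;> rfl

theorem swap_lt_iff {n : ℕ} (p q : Fin n) (h : (p : ℕ) + 1 = q) (x y : Fin n)
    (h1 : ¬ ((x : ℕ) = p ∧ (y : ℕ) = q)) (h2 : ¬ ((x : ℕ) = q ∧ (y : ℕ) = p)) :
    (Equiv.swap p q x : ℕ) < Equiv.swap p q y ↔ (x : ℕ) < y := by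
  rw [swap_val, swap_val]
  split_ifs <;> omega

theorem rel_of_symm_apply (R : Orthogonality C) {c : Profile C} {t : C} (f : ∀ i, c.color i ⟶ t)
    (σ : Fin c.len ≃ Fin c.len) {p q x y : Fin c.len} (hx : σ.symm p = x) (hy : σ.symm q = y)
    (h : R.Rel (f (σ.symm p)) (f (σ.symm q))) : R.Rel (f x) (f y) := by
  subst hx hy
  exact h

/-- Two orderings are related by transpositions of adjacent orthogonal pairs if and only if
they order all non-orthogonal pairs in the same way. -/
theorem reflTransGen_iff (R : Orthogonality C) {c : Profile C} {t : C} (f : ∀ i, c.color i ⟶ t)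
    (σ σ' : Fin c.len ≃ Fin c.len) : Relation.ReflTransGen (AdjacentSwap R f) σ σ' ↔
      ∀ i j, ¬ R.Rel (f i) (f j) → ((σ i : ℕ) < σ j ↔ (σ' i : ℕ) < σ' j) := by
  constructor
  · intro h
    induction h with
    | refl => exact fun _ _ _ => Iff.rfl
    | tail _ h ih =>
      rename_i τ τ' _
      obtain ⟨p, q, hpq, hR, rfl⟩ := h
      intro i j hij
      rw [ih i j hij]
      refine (swap_lt_iff p q hpq (τ i) (τ j) ?_ ?_).symm
      · rintro ⟨h1, h2⟩
        obtain rfl := Fin.ext h1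
        obtain rfl := Fin.ext h2
        exact hij (rel_of_symm_apply R f _ (Equiv.symm_apply_apply _ _) (Equiv.symm_apply_apply _ _) hR)
      · rintro ⟨h1, h2⟩
        obtain rfl := Fin.ext h1
        obtain rfl := Fin.ext h2
        exact hij (R.symm (rel_of_symm_apply R f _ (Equiv.symm_apply_apply _ _)
            (Equiv.symm_apply_apply _ _) hR))
  · intro h
    generalize hN : (Finset.univ.filter fun x : Fin c.len × Fin c.len =>
      (σ x.1 : ℕ) < σ x.2 ∧ (σ' x.2 : ℕ) < σ' x.1).card = N
    induction N using Nat.strong_induction_on generalizing σ with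
    | _ N ih =>
      by_cases hs : ∃ p q : Fin c.len, (p : ℕ) + 1 = q ∧ (σ' (σ.symm q) : ℕ) < σ' (σ.symm p)
      · obtain ⟨p, q, hpq, hlt⟩ := hs
        have hR : R.Rel (f (σ.symm p)) (f (σ.symm q)) := by
          by_contra hR
          have := (h _ _ hR).1 (by simp; omega)
          omega
        refine Relation.ReflTransGen.head ⟨p, q, hpq, hR, rfl⟩ (ih _ ?_ _ ?_ rfl)
        · rw [← hN]
          refine Finset.card_lt_card (Finset.ssubset_iff_of_subset ?_ |>.2
            ⟨(σ.symm p, σ.symm q), ?_, ?_⟩)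
          · intro x hx
            have hx := (Finset.mem_filter.1 hx).2
            simp only [Equiv.trans_apply] at hx
            refine Finset.mem_filter.2 ⟨Finset.mem_univ _, ?_, hx.2⟩
            by_cases h2 : (σ x.1 : ℕ) = q ∧ (σ x.2 : ℕ) = p
            · have e1 : x.1 = σ.symm q := by rw [← Fin.ext h2.1, Equiv.symm_apply_apply]
              have e2 : x.2 = σ.symm p := by rw [← Fin.ext h2.2, Equiv.symm_apply_apply]
              have := hx.2
              rw [e1, e2] at this
              omega
            · by_cases h1 : (σ x.1 : ℕ) = p ∧ (σ x.2 : ℕ) = q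
              · omega
              · exact (swap_lt_iff p q hpq _ _ h1 h2).1 hx.1
          · refine Finset.mem_filter.2 ⟨Finset.mem_univ _, ?_, hlt⟩
            simp only [Equiv.apply_symm_apply]
            omega
          · intro hx
            have hx := (Finset.mem_filter.1 hx).2.1
            simp only [Equiv.trans_apply, Equiv.apply_symm_apply, Equiv.swap_apply_left,
              Equiv.swap_apply_right] at hx
            omega
        · intro i j hij
          rw [← h i j hij]
          refine swap_lt_iff p q hpq (σ i) (σ j) ?_ ?_
          · rintro ⟨h1, h2⟩
            obtain rfl := Fin.ext h1
            obtain rfl := Fin.ext h2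
            exact hij (rel_of_symm_apply R f _ (Equiv.symm_apply_apply _ _) (Equiv.symm_apply_apply _ _) hR)
          · rintro ⟨h1, h2⟩
            obtain rfl := Fin.ext h1
            obtain rfl := Fin.ext h2
            exact hij (R.symm (rel_of_symm_apply R f _ (Equiv.symm_apply_apply _ _)
            (Equiv.symm_apply_apply _ _) hR))
      · have hmono : ∀ (k : ℕ) (p q : Fin c.len), (p : ℕ) + k + 1 = q →
            (σ' (σ.symm p) : ℕ) < σ' (σ.symm q) := by
          intro k
          induction k with
          | zero =>
            intro p q hpq
            by_contra hlt
            have hne : (σ' (σ.symm p) : ℕ) ≠ σ' (σ.symm q) := fun e => by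
              have := σ.symm.injective (σ'.injective (Fin.ext e))
              rw [this] at hpq
              omega
            exact hs ⟨p, q, by omega, by omega⟩
          | succ k ihk =>
            intro p q hpq
            have hq := q.2
            have h1 := ihk p ⟨(p : ℕ) + k + 1, by omega⟩ rfl
            have h2 : (σ' (σ.symm ⟨(p : ℕ) + k + 1, by omega⟩) : ℕ) < σ' (σ.symm q) := by
              by_contra hlt
              have hne : (σ' (σ.symm ⟨(p : ℕ) + k + 1, by omega⟩) : ℕ) ≠ σ' (σ.symm q) :=
                fun e => by
                  have := σ.symm.injective (σ'.injective (Fin.ext e))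
                  rw [← this] at hpq
                  simp at hpq
              exact hs ⟨⟨(p : ℕ) + k + 1, by omega⟩, q, by simp; omega, by omega⟩
            omega
        have : σ = σ' := equiv_eq_of_lt_iff _ _ fun i j hij => by
          have := hmono ((σ j : ℕ) - σ i - 1) (σ i) (σ j) (by omega)
          simpa using this
        rw [this]

namespace FreeOp

open Profile

theorem equivalent_iff (R : Orthogonality C) {c : Profile C} {t : C} (p q : FreeOp C c t) :
    p.Equivalent R q ↔ p.hom = q.hom ∧ ∀ i j, ¬ R.Rel (p.hom i) (p.hom j) →
      ((p.perm i : ℕ) < p.perm j ↔ (q.perm i : ℕ) < q.perm j) :=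
  and_congr_right fun _ => reflTransGen_iff R _ _ _

/-- The relation `∼_⊥` as a setoid. -/
def setoid (R : Orthogonality C) (c : Profile C) (t : C) : Setoid (FreeOp C c t) where
  r p q := p.Equivalent R q
  iseqv :=
    { refl := fun _ => ⟨rfl, .refl⟩
      symm := fun {p q} h => by
        rw [equivalent_iff] at h ⊢
        exact ⟨h.1.symm, fun i j hij => (h.2 i j (by rwa [h.1])).symm⟩
      trans := fun {p q r} h h' => by
        rw [equivalent_iff] at h h' ⊢
        exact ⟨h.1.trans h'.1, fun i j hij => (h.2 i j hij).trans (h'.2 i j (by rwa [← h.1]))⟩ }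

theorem Equivalent.map {R : Orthogonality C} {c d : Profile C} {t : C} (h : c ⟶ d)
    {p q : FreeOp C c t} (hpq : p.Equivalent R q) : (p.map h).Equivalent R (q.map h) := by
  rw [equivalent_iff] at hpq ⊢
  refine ⟨funext fun i => congrArg (_ ≫ ·) (congrFun hpq.1 _), fun i j hij => ?_⟩
  exact hpq.2 (Hom.perm h i) (Hom.perm h j) fun h' => hij (R.precomp _ _ h')

theorem Equivalent.comp {R : Orthogonality C} {t : C} {a : Profile C}
    (b : Fin a.len → Profile C) {p p' : FreeOp C a t} {q q' : ∀ i, FreeOp C (b i) (a.color i)}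
    (hp : p.Equivalent R p') (hq : ∀ i, (q i).Equivalent R (q' i)) :
    (FreeOp.comp b p q).Equivalent R (FreeOp.comp b p' q') := by
  simp only [equivalent_iff] at hp hq ⊢
  refine ⟨funext fun x => ?_, fun x y hxy => ?_⟩
  · exact congrArg₂ (· ≫ ·) (congrFun (hq _).1 _) (congrFun hp.1 _)
  · rw [comp_lt b p q x y _ _ rfl rfl, comp_lt b p' q' x y _ _ rfl rfl]
    have hxy' : ¬ R.Rel ((q (locate _ x).1).hom (locate _ x).2 ≫ p.hom (locate _ x).1)
      ((q (locate _ y).1).hom (locate _ y).2 ≫ p.hom (locate _ y).1) := hxy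
    revert hxy'
    generalize locate (fun i => (b i).len) x = x'
    generalize locate (fun i => (b i).len) y = y'
    obtain ⟨i, j⟩ := x'
    obtain ⟨i', j'⟩ := y'
    intro hxy'
    by_cases hi : i = i'
    · subst hi
      have := (hq i).2 j j' fun h => hxy' (R.postcomp _ h)
      simpa using this
    · have h1 := hp.2 i i' fun h => hxy' (R.precomp _ _ h)
      have h2 : (p.perm i : ℕ) ≠ p.perm i' := fun e => hi (p.perm.injective (Fin.ext e))
      have h3 : (p'.perm i : ℕ) ≠ p'.perm i' := fun e => hi (p'.perm.injective (Fin.ext e))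
      simp [h1, h2, h3]

end FreeOp

/-- The operations of the operad of an orthogonal category. -/
def OrthOp (R : Orthogonality C) (c : Profile C) (t : C) : Type v :=
  Quotient (FreeOp.setoid R c t)

namespace OrthOp

open Profile

variable {R : Orthogonality C}

/-- The class `[σ, f]`. -/
def mk (R : Orthogonality C) {c : Profile C} {t : C} (p : FreeOp C c t) : OrthOp R c t :=
  Quotient.mk _ p

theorem mk_eq {c : Profile C} {t : C} {p q : FreeOp C c t} (h : p.Equivalent R q) :
    mk R p = mk R q := Quotient.sound h

/-- A representative. -/
noncomputable def out {c : Profile C} {t : C} (p : OrthOp R c t) : FreeOp C c t :=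
  Quotient.out p

theorem mk_out {c : Profile C} {t : C} (p : OrthOp R c t) : mk R p.out = p := Quotient.out_eq p

theorem out_mk {c : Profile C} {t : C} (p : FreeOp C c t) : (mk R p).out.Equivalent R p :=
  Quotient.mk_out (s := FreeOp.setoid R c t) p

/-- The action of right permutations, on classes. -/
noncomputable def map {c d : Profile C} {t : C} (h : c ⟶ d) (p : OrthOp R c t) : OrthOp R d t :=
  mk R (p.out.map h)

/-- The operadic composition, on classes. -/
noncomputable def comp {t : C} {a : Profile C} (b : Fin a.len → Profile C) (p : OrthOp R a t)
    (q : ∀ i, OrthOp R (b i) (a.color i)) : OrthOp R (concat b) t :=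
  mk R (FreeOp.comp b p.out fun i => (q i).out)

theorem map_mk {c d : Profile C} {t : C} (h : c ⟶ d) (p : FreeOp C c t) :
    map h (mk R p) = mk R (p.map h) := mk_eq ((out_mk p).map h)

theorem comp_mk {t : C} {a : Profile C} (b : Fin a.len → Profile C) (p : FreeOp C a t)
    (q : ∀ i, FreeOp C (b i) (a.color i)) :
    comp b (mk R p) (fun i => mk R (q i)) = mk R (FreeOp.comp b p q) :=
  mk_eq ((out_mk p).comp b fun i => out_mk (q i))

theorem exists_rep {c : Profile C} {t : C} (p : OrthOp R c t) : ∃ q, mk R q = p := ⟨_, mk_out p⟩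

theorem exists_reps {ι : Type*} {c : ι → Profile C} {t : ι → C} (p : ∀ i, OrthOp R (c i) (t i)) :
    ∃ q : ∀ i, FreeOp C (c i) (t i), (fun i => mk R (q i)) = p :=
  ⟨fun i => (p i).out, funext fun i => mk_out (p i)⟩

end OrthOp

/-- The operad `O_(C, ⊥)` of an orthogonal category, with values in sets: the quotient of the
operad `O_C` by `∼_⊥`. -/
noncomputable def orthOperad (R : Orthogonality C) : SetOperad.{u, v} C where
  obj c t := OrthOp R c t
  map h p := OrthOp.map h p
  map_id p := by
    obtain ⟨p, rfl⟩ := p.exists_rep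
    exact (OrthOp.map_mk _ _).trans (congrArg _ ((freeOperad C).map_id p))
  map_comp g h p := by
    obtain ⟨p, rfl⟩ := p.exists_rep
    simp only [OrthOp.map_mk]
    exact congrArg _ ((freeOperad C).map_comp g h p)
  one t := OrthOp.mk R (FreeOp.one t)
  comp b p q := OrthOp.comp b p q
  comp_perm {t a} b p q n σ := by
    obtain ⟨p, rfl⟩ := p.exists_rep
    obtain ⟨q, rfl⟩ := OrthOp.exists_reps q
    simp only [OrthOp.map_mk, OrthOp.comp_mk]
    refine (OrthOp.comp_mk (a := a.reindex σ) (fun j => b (σ j)) _ fun j => q (σ j)).trans ?_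
    exact congrArg _ ((freeOperad C).comp_perm b p q σ)
  comp_map {t a} b b' p q σ := by
    obtain ⟨p, rfl⟩ := p.exists_rep
    obtain ⟨q, rfl⟩ := OrthOp.exists_reps q
    simp only [OrthOp.map_mk, OrthOp.comp_mk]
    exact congrArg _ ((freeOperad C).comp_map b b' p q σ)
  assoc {t a} b c p q r := by
    obtain ⟨p, rfl⟩ := p.exists_rep
    obtain ⟨q, rfl⟩ := OrthOp.exists_reps q
    obtain ⟨r, hr⟩ : ∃ r' : ∀ i j, FreeOp C (c i j) ((b i).color j),
        (fun i j => OrthOp.mk R (r' i j)) = r :=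
      ⟨fun i j => (r i j).out, funext fun i => funext fun j => OrthOp.mk_out (r i j)⟩
    subst hr
    simp only [OrthOp.comp_mk]
    refine (congrArg (OrthOp.map _)
      (OrthOp.comp_mk (a := Profile.concat b) (Profile.flat b c) _ _)).trans ?_
    refine (OrthOp.map_mk _ _).trans ?_
    exact congrArg _ ((freeOperad C).assoc b c p q r)
  comp_one {t a} p := by
    obtain ⟨p, rfl⟩ := p.exists_rep
    simp only [OrthOp.map_mk]
    refine (OrthOp.comp_mk _ _ _).trans ?_
    exact congrArg _ ((freeOperad C).comp_one p)
  one_comp {t a} p := by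
    obtain ⟨p, rfl⟩ := p.exists_rep
    simp only [OrthOp.map_mk]
    refine (OrthOp.comp_mk (a := Profile.single t) (fun _ => a) _ _).trans ?_
    exact congrArg _ ((freeOperad C).one_comp p)

/-- Application of a functor to the morphisms of an operation, `(σ, f) ↦ (σ, F f)`. -/
def FreeOp.mapFunctor {D : Type*} [Category D] (F : C ⥤ D) {c : Profile C} {t : C}
    (p : FreeOp C c t) : FreeOp D (c.map F.obj) (F.obj t) where
  perm := p.perm
  hom i := F.map (p.hom i)

theorem FreeOp.Equivalent.mapFunctor {D : Type*} [Category D] {R : Orthogonality C}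
    {S : Orthogonality D} (F : OrthFunctor R S) {c : Profile C} {t : C} {p q : FreeOp C c t}
    (h : p.Equivalent R q) :
    (p.mapFunctor F.functor).Equivalent S (q.mapFunctor F.functor) := by
  rw [FreeOp.equivalent_iff] at h ⊢
  exact ⟨funext fun i => congrArg F.functor.map (congrFun h.1 i),
    fun i j hij => h.2 i j fun h' => hij (F.map_rel h')⟩

namespace OrthOp

variable {D : Type*} [Category D] {R : Orthogonality C} {S : Orthogonality D}

/-- The map `[σ, f] ↦ [σ, F f]`. -/
noncomputable def mapFunctor (F : OrthFunctor R S) {c : Profile C} {t : C} (p : OrthOp R c t) :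
    OrthOp S (c.map F.functor.obj) (F.functor.obj t) :=
  mk S (p.out.mapFunctor F.functor)

theorem mapFunctor_mk (F : OrthFunctor R S) {c : Profile C} {t : C} (p : FreeOp C c t) :
    mapFunctor F (mk R p) = mk S (p.mapFunctor F.functor) := mk_eq ((out_mk p).mapFunctor F)

theorem mapFunctor_map (F : OrthFunctor R S) {c d : Profile C} {t : C} (h : c ⟶ d)
    (p : OrthOp R c t) :
    mapFunctor F (map h p) = map (Profile.mapHom F.functor.obj h) (mapFunctor F p) := by
  obtain ⟨p, rfl⟩ := p.exists_rep
  rw [map_mk, mapFunctor_mk, mapFunctor_mk, map_mk]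
  refine congrArg _ (FreeOp.ext rfl (funext fun i => ?_))
  exact (F.functor.map_comp _ _).trans (congrArg (· ≫ _) (eqToHom_map _ _))

theorem mapFunctor_comp (F : OrthFunctor R S) {t : C} {a : Profile C}
    (b : Fin a.len → Profile C) (p : OrthOp R a t) (q : ∀ i, OrthOp R (b i) (a.color i)) :
    mapFunctor F (comp b p q) = comp (a := a.map F.functor.obj)
      (fun i => (b i).map F.functor.obj) (mapFunctor F p) (fun i => mapFunctor F (q i)) := by
  obtain ⟨p, rfl⟩ := p.exists_rep
  obtain ⟨q, rfl⟩ := exists_reps q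
  rw [comp_mk, mapFunctor_mk, mapFunctor_mk]
  simp only [mapFunctor_mk]
  refine Eq.trans ?_ (comp_mk (a := a.map F.functor.obj)
    (fun i => (b i).map F.functor.obj) _ _).symm
  exact congrArg _ (FreeOp.ext rfl (funext fun i => F.functor.map_comp _ _))

end OrthOp

/-- The morphism of operads `O_F : O_(C, ⊥_C) → O_(D, ⊥_D)`, `[σ, f] ↦ [σ, F f]`, in sets. -/
noncomputable def orthOperadHom {D : Type*} [Category D] {R : Orthogonality C}
    {S : Orthogonality D} (F : OrthFunctor R S) : (orthOperad R).Hom (orthOperad S) where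
  color := F.functor.obj
  app p := OrthOp.mapFunctor F p
  app_map h p := OrthOp.mapFunctor_map F h p
  app_one t := (OrthOp.mapFunctor_mk F _).trans
    (congrArg _ (FreeOp.ext rfl (funext fun _ => F.functor.map_id t)))
  app_comp b p q := OrthOp.mapFunctor_comp F b p q

end

/-! ### Finite tensor products in a symmetric monoidal category -/

section Tensor

variable {M : Type u} [Category.{v} M] [MonoidalCategory M]

/-- The tensor product `X_1 ⊗ ⋯ ⊗ X_n` of a finite sequence of objects. -/
def tens : {n : ℕ} → (Fin n → M) → M
  | 0, _ => 𝟙_ M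
  | n + 1, X => tens (fun i : Fin n => X i.castSucc) ⊗ X (Fin.last n)

/-- The tensor product of a finite sequence of morphisms. -/
def tensMap : {n : ℕ} → {X Y : Fin n → M} → (∀ i, X i ⟶ Y i) → (tens X ⟶ tens Y)
  | 0, _, _, _ => 𝟙 (𝟙_ M)
  | n + 1, _, _, f => tensMap (fun i : Fin n => f i.castSucc) ⊗ₘ f (Fin.last n)

theorem tensMap_id : {n : ℕ} → (X : Fin n → M) → tensMap (fun i => 𝟙 (X i)) = 𝟙 (tens X)
  | 0, _ => rfl
  | n + 1, X => by
    simp only [tensMap, tensMap_id (fun i : Fin n => X i.castSucc)]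
    exact id_tensorHom_id _ _

theorem tensMap_comp : {n : ℕ} → {X Y Z : Fin n → M} → (f : ∀ i, X i ⟶ Y i) →
    (g : ∀ i, Y i ⟶ Z i) → tensMap f ≫ tensMap g = tensMap (fun i => f i ≫ g i)
  | 0, _, _, _, _, _ => Category.id_comp _
  | n + 1, _, _, _, f, g => by
    simp only [tensMap, ← tensMap_comp (fun i : Fin n => f i.castSucc) fun i : Fin n => g i.castSucc]
    exact tensorHom_comp_tensorHom _ _ _ _

/-- The canonical morphism `I ⊗ ⋯ ⊗ I ⟶ I`. -/
def collapse : (n : ℕ) → (tens (fun _ : Fin n => 𝟙_ M) ⟶ 𝟙_ M)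
  | 0 => 𝟙 _
  | n + 1 => collapse n ▷ 𝟙_ M ≫ (ρ_ (𝟙_ M)).hom

/-- The tensor product of a sequence of length one. -/
def tensOne (X : Fin 1 → M) : tens X ⟶ X 0 := (λ_ (X 0)).hom

/-- The tensor product of a concatenated sequence. -/
def tensAppend {a : ℕ} : {b : ℕ} → (X : Fin (a + b) → M) →
    (tens X ⟶ tens (fun i => X (Fin.castAdd b i)) ⊗ tens (fun j => X (Fin.natAdd a j)))
  | 0, X => (ρ_ (tens X)).inv
  | b + 1, X => tensAppend (fun i : Fin (a + b) => X i.castSucc) ▷ X (Fin.last (a + b)) ≫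
      (α_ _ _ _).hom

variable [SymmetricCategory M]

/-- The canonical morphism
`X_1 ⊗ ⋯ ⊗ X_m ⊗ (⊗_{(i,j)} W_{ij}) ⟶ ⊗_i (X_i ⊗ (⊗_j W_{ij}))`, which permutes the factors. -/
def distrib : {m : ℕ} → {k : Fin m → ℕ} → (X : Fin m → M) → (W : ∀ i, Fin (k i) → M) →
    (tens X ⊗ tens (fun p => W (locate k p).1 (locate k p).2) ⟶
      tens (fun i => X i ⊗ tens (W i)))
  | 0, _, _, _ => (λ_ (𝟙_ M)).hom
  | m + 1, k, X, W =>
    (tens X ◁ (tensAppend (fun p : Fin (_ + k (Fin.last m)) =>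
        W (locate k p).1 (locate k p).2) ≫
      (tensMap (fun p => eqToHom (congrArg (fun x : Σ i, Fin (k i) => W x.1 x.2)
          (locate_castAdd k p))) ⊗ₘ
        tensMap (fun j => eqToHom (congrArg (fun x : Σ i, Fin (k i) => W x.1 x.2)
          (locate_natAdd k j)))))) ≫
      tensorμ _ _ _ _ ≫
      distrib (fun i : Fin m => X i.castSucc) (fun i : Fin m => W i.castSucc) ▷ _

/-- Interchange of the last two tensor factors. -/
def swapLast (A B C : M) : (A ⊗ B) ⊗ C ⟶ (A ⊗ C) ⊗ B :=
  (α_ A B C).hom ≫ A ◁ (β_ B C).hom ≫ (α_ A C B).inv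

theorem castSucc_succAbove_last {n : ℕ} (k : Fin (n + 1)) :
    k.castSucc.succAbove (Fin.last n) = Fin.last (n + 1) :=
  Fin.succAbove_ne_last_last (Fin.castSucc_lt_last k).ne

/-- The canonical morphism moving the `k`-th tensor factor to the last position. -/
def extract : {n : ℕ} → (X : Fin (n + 1) → M) → (k : Fin (n + 1)) →
    (tens X ⟶ tens (fun i => X (k.succAbove i)) ⊗ X k)
  | 0, X, k => 𝟙 (𝟙_ M) ⊗ₘ eqToHom (congrArg X (Subsingleton.elim (α := Fin 1) 0 k))
  | n + 1, X, k => Fin.lastCases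
      (motive := fun k => (tens X ⟶ tens (fun i => X (k.succAbove i)) ⊗ X k))
      (tensMap (fun i => eqToHom (congrArg X (Fin.succAbove_last_apply i).symm)) ⊗ₘ
        𝟙 (X (Fin.last (n + 1))))
      (fun k => extract (fun i : Fin (n + 1) => X i.castSucc) k ▷ X (Fin.last (n + 1)) ≫
        swapLast _ _ _ ≫
        (tensMap (fun i => eqToHom (congrArg X (Fin.castSucc_succAbove_castSucc).symm)) ⊗ₘ
          eqToHom (congrArg X (castSucc_succAbove_last k).symm)) ▷ X k.castSucc) k

/-- The bijection induced by `e` after removing the last element and its image. -/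
def removeLast {n m : ℕ} (e : Fin (n + 1) ≃ Fin (m + 1)) : Fin n ≃ Fin m :=
  (finSuccAboveEquiv (Fin.last n)).trans
    ((e.subtypeEquiv (fun a => by simp)).trans (finSuccAboveEquiv (e (Fin.last n))).symm)

theorem succAbove_removeLast {n m : ℕ} (e : Fin (n + 1) ≃ Fin (m + 1)) (j : Fin n) :
    (e (Fin.last n)).succAbove (removeLast e j) = e j.castSucc := by
  have h := congrArg Subtype.val ((finSuccAboveEquiv (e (Fin.last n))).apply_symm_apply
    (e.subtypeEquiv (p := (· ≠ Fin.last n)) (q := (· ≠ e (Fin.last n))) (fun a => by simp)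
      (finSuccAboveEquiv (Fin.last n) j)))
  refine Eq.trans ?_ (h.trans ?_)
  · rfl
  · exact congrArg e (Fin.succAbove_last_apply j)

/-- The permutation of tensor factors `X_1 ⊗ ⋯ ⊗ X_n ⟶ X_{σ 1} ⊗ ⋯ ⊗ X_{σ n}`. -/
def tensPerm : {n m : ℕ} → (σ : Fin n ≃ Fin m) → (X : Fin m → M) →
    (tens X ⟶ tens (fun j => X (σ j)))
  | 0, 0, _, _ => 𝟙 _
  | 0, _ + 1, σ, _ => (σ.symm 0).elim0
  | _ + 1, 0, σ, _ => (σ 0).elim0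
  | n + 1, m + 1, σ, X => extract X (σ (Fin.last n)) ≫
      (tensPerm (removeLast σ) (fun i => X ((σ (Fin.last n)).succAbove i)) ≫
        tensMap (fun j => eqToHom (congrArg X (succAbove_removeLast σ j)))) ▷ X (σ (Fin.last n))

/-! Naturality of these morphisms, and their compatibility with `collapse`. -/

theorem append_aux {A A' B B' C C' D D' : M} {f : A ⟶ A'} {t : A ⟶ B ⊗ C} {t' : A' ⟶ B' ⊗ C'}
    {g : B ⟶ B'} {h : C ⟶ C'} (l : D ⟶ D') (H : f ≫ t' = t ≫ (g ⊗ₘ h)) :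
    (f ⊗ₘ l) ≫ t' ▷ D' ≫ (α_ B' C' D').hom = (t ▷ D ≫ (α_ B C D).hom) ≫ (g ⊗ₘ (h ⊗ₘ l)) := by
  rw [Category.assoc, ← associator_naturality, ← tensorHom_id, ← tensorHom_id,
    tensorHom_comp_tensorHom_assoc, tensorHom_comp_tensorHom_assoc, H, Category.comp_id,
    Category.id_comp]

theorem append_zero_aux {A A' : M} (f : A ⟶ A') :
    f ≫ (ρ_ A').inv = (ρ_ A).inv ≫ (f ⊗ₘ 𝟙 (𝟙_ M)) := by
  simp

theorem tensAppend_natural {a : ℕ} : {b : ℕ} → {X Y : Fin (a + b) → M} → (f : ∀ i, X i ⟶ Y i) →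
    tensMap f ≫ tensAppend Y =
      tensAppend X ≫ (tensMap (fun i => f (Fin.castAdd b i)) ⊗ₘ tensMap fun j => f (Fin.natAdd a j))
  | 0, _, _, f => append_zero_aux (tensMap f)
  | b + 1, _, _, f => append_aux (f (Fin.last (a + b)))
      (tensAppend_natural (fun i : Fin (a + b) => f i.castSucc))

theorem tensMap_eqToHom {n : ℕ} {A : Type*} {X Y : A → M} (f : ∀ a, X a ⟶ Y a)
    {u v : Fin n → A} (h : ∀ i, u i = v i) :
    tensMap (fun i => f (u i)) ≫ tensMap (fun i => eqToHom (congrArg Y (h i))) =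
      tensMap (fun i => eqToHom (congrArg X (h i))) ≫ tensMap (fun i => f (v i)) := by
  rw [tensMap_comp, tensMap_comp]
  exact congrArg tensMap (funext fun i => eqToHom_naturality f (h i))

theorem distrib_aux {X₁ X₂ Y₁ Y₂ A A' B B' C C' D D' E E' Q Q' : M} {f₁ : X₁ ⟶ Y₁} {f₂ : X₂ ⟶ Y₂}
    {G : A ⟶ A'} {t : A ⟶ B ⊗ C} {t' : A' ⟶ B' ⊗ C'} {g : B ⟶ B'} {h : C ⟶ C'}
    {u : B ⟶ D} {u' : B' ⟶ D'} {w : C ⟶ E} {w' : C' ⟶ E'} {g₁ : D ⟶ D'} {h₁ : E ⟶ E'}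
    {d : X₁ ⊗ D ⟶ Q} {d' : Y₁ ⊗ D' ⟶ Q'} {r : Q ⟶ Q'}
    (H₁ : G ≫ t' = t ≫ (g ⊗ₘ h)) (H₂ : g ≫ u' = u ≫ g₁) (H₃ : h ≫ w' = w ≫ h₁)
    (H₄ : (f₁ ⊗ₘ g₁) ≫ d' = d ≫ r) :
    ((f₁ ⊗ₘ f₂) ⊗ₘ G) ≫ (Y₁ ⊗ Y₂) ◁ (t' ≫ (u' ⊗ₘ w')) ≫ tensorμ Y₁ Y₂ D' E' ≫ d' ▷ (Y₂ ⊗ E') =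
      ((X₁ ⊗ X₂) ◁ (t ≫ (u ⊗ₘ w)) ≫ tensorμ X₁ X₂ D E ≫ d ▷ (X₂ ⊗ E)) ≫ (r ⊗ₘ (f₂ ⊗ₘ h₁)) := by
  have e : G ≫ t' ≫ (u' ⊗ₘ w') = (t ≫ (u ⊗ₘ w)) ≫ (g₁ ⊗ₘ h₁) := by
    rw [reassoc_of% H₁, tensorHom_comp_tensorHom, H₂, H₃, Category.assoc,
      tensorHom_comp_tensorHom]
  rw [← id_tensorHom, tensorHom_comp_tensorHom_assoc, e, Category.comp_id,
    ← Category.id_comp (f₁ ⊗ₘ f₂), ← tensorHom_comp_tensorHom_assoc, tensorμ_natural_assoc,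
    ← tensorHom_id, tensorHom_comp_tensorHom, H₄, Category.assoc, Category.assoc, id_tensorHom,
    ← tensorHom_id, tensorHom_comp_tensorHom]
  simp

theorem distrib_zero_aux : (𝟙 (𝟙_ M) ⊗ₘ 𝟙 (𝟙_ M)) ≫ (λ_ (𝟙_ M)).hom = (λ_ (𝟙_ M)).hom ≫ 𝟙 (𝟙_ M) := by
  simp

theorem distrib_natural : {m : ℕ} → {k : Fin m → ℕ} → {X Y : Fin m → M} →
    {V W : ∀ i, Fin (k i) → M} → (f : ∀ i, X i ⟶ Y i) → (g : ∀ i j, V i j ⟶ W i j) →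
    (tensMap f ⊗ₘ tensMap (fun p => g (locate k p).1 (locate k p).2)) ≫ distrib Y W =
      distrib X V ≫ tensMap (fun i => f i ⊗ₘ tensMap (g i))
  | 0, _, _, _, _, _, _, _ => distrib_zero_aux
  | m + 1, k, _, _, V, W, f, g =>
    distrib_aux
      (tensAppend_natural (a := total fun i : Fin m => k i.castSucc) (b := k (Fin.last m))
        fun p => g (locate k p).1 (locate k p).2)
      (tensMap_eqToHom (X := fun x : Σ i, Fin (k i) => V x.1 x.2) (fun x => g x.1 x.2)
        (locate_castAdd k))
      (tensMap_eqToHom (X := fun x : Σ i, Fin (k i) => V x.1 x.2) (fun x => g x.1 x.2)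
        (locate_natAdd k))
      (distrib_natural (fun i : Fin m => f i.castSucc) fun i : Fin m => g i.castSucc)

theorem swapLast_natural {A A' B B' C C' : M} (f : A ⟶ A') (g : B ⟶ B') (h : C ⟶ C') :
    ((f ⊗ₘ g) ⊗ₘ h) ≫ swapLast A' B' C' = swapLast A B C ≫ ((f ⊗ₘ h) ⊗ₘ g) := by
  simp only [swapLast]
  rw [associator_naturality_assoc, ← id_tensorHom, ← id_tensorHom, tensorHom_comp_tensorHom_assoc,
    BraidedCategory.braiding_naturality, Category.assoc, Category.assoc,
    ← associator_inv_naturality, tensorHom_comp_tensorHom_assoc, Category.comp_id,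
    Category.id_comp]

theorem extract_aux {A A' B B' C C' P P' D D' E E' : M} {F : P ⟶ P'} {x : P ⟶ A ⊗ B}
    {x' : P' ⟶ A' ⊗ B'} {f : A ⟶ A'} {g : B ⟶ B'} {h : C ⟶ C'} {u : A ⟶ D} {u' : A' ⟶ D'}
    {e : C ⟶ E} {e' : C' ⟶ E'} {f₁ : D ⟶ D'} {h₁ : E ⟶ E'}
    (H₁ : F ≫ x' = x ≫ (f ⊗ₘ g)) (H₂ : f ≫ u' = u ≫ f₁) (H₃ : h ≫ e' = e ≫ h₁) :
    (F ⊗ₘ h) ≫ x' ▷ C' ≫ swapLast A' B' C' ≫ (u' ⊗ₘ e') ▷ B' =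
      (x ▷ C ≫ swapLast A B C ≫ (u ⊗ₘ e) ▷ B) ≫ ((f₁ ⊗ₘ h₁) ⊗ₘ g) := by
  rw [← tensorHom_id, tensorHom_comp_tensorHom_assoc, H₁, Category.comp_id,
    ← Category.id_comp h, ← tensorHom_comp_tensorHom_assoc, reassoc_of% (swapLast_natural (M := M)),
    ← tensorHom_id, tensorHom_comp_tensorHom, tensorHom_comp_tensorHom, H₂, H₃, Category.assoc,
    Category.assoc, ← tensorHom_id (u ⊗ₘ e) B, tensorHom_comp_tensorHom, tensorHom_comp_tensorHom,
    Category.comp_id, Category.id_comp, tensorHom_id]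

theorem extract_last {n : ℕ} (X : Fin (n + 2) → M) : extract X (Fin.last (n + 1)) =
    tensMap (fun i => eqToHom (congrArg X (Fin.succAbove_last_apply i).symm)) ⊗ₘ
        𝟙 (X (Fin.last (n + 1))) :=
  Fin.lastCases_last
    (motive := fun k => (tens X ⟶ tens (fun i => X (k.succAbove i)) ⊗ X k))

theorem extract_castSucc {n : ℕ} (X : Fin (n + 2) → M) (k : Fin (n + 1)) :
    extract X k.castSucc =
      extract (fun i : Fin (n + 1) => X i.castSucc) k ▷ X (Fin.last (n + 1)) ≫
        swapLast _ _ _ ≫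
        (tensMap (fun i => eqToHom (congrArg X (Fin.castSucc_succAbove_castSucc).symm)) ⊗ₘ
          eqToHom (congrArg X (castSucc_succAbove_last k).symm)) ▷ X k.castSucc :=
  Fin.lastCases_castSucc
    (motive := fun k => (tens X ⟶ tens (fun i => X (k.succAbove i)) ⊗ X k)) k

theorem extract_natural : {n : ℕ} → {X Y : Fin (n + 1) → M} → (f : ∀ i, X i ⟶ Y i) →
    (k : Fin (n + 1)) → tensMap f ≫ extract Y k =
      extract X k ≫ (tensMap (fun i => f (k.succAbove i)) ⊗ₘ f k)
  | 0, X, Y, f, k => by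
    refine (tensorHom_comp_tensorHom _ _ _ _).trans
      (Eq.trans ?_ (tensorHom_comp_tensorHom _ _ _ _).symm)
    exact congrArg₂ (· ⊗ₘ ·) rfl (eqToHom_naturality f (Subsingleton.elim (α := Fin 1) 0 k))
  | n + 1, X, Y, f, k => by
    induction k using Fin.lastCases with
    | last =>
      rw [extract_last, extract_last]
      refine (tensorHom_comp_tensorHom _ _ _ _).trans
        (Eq.trans ?_ (tensorHom_comp_tensorHom _ _ _ _).symm)
      exact congrArg₂ (· ⊗ₘ ·) (tensMap_eqToHom f fun i => (Fin.succAbove_last_apply i).symm)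
        ((Category.comp_id _).trans (Category.id_comp _).symm)
    | cast k =>
      rw [extract_castSucc, extract_castSucc]
      exact extract_aux (extract_natural (fun i : Fin (n + 1) => f i.castSucc) k)
        (tensMap_eqToHom f fun i => (Fin.castSucc_succAbove_castSucc).symm)
        (eqToHom_naturality f (castSucc_succAbove_last k).symm)

theorem perm_aux {P P' A A' B B' C C' D D' : M} {F : P ⟶ P'} {x : P ⟶ A ⊗ B} {x' : P' ⟶ A' ⊗ B'}
    {f : A ⟶ A'} {g : B ⟶ B'} {u : A ⟶ C} {u' : A' ⟶ C'} {h : C ⟶ C'} {e : C ⟶ D} {e' : C' ⟶ D'}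
    {l : D ⟶ D'} (H₁ : F ≫ x' = x ≫ (f ⊗ₘ g)) (H₂ : f ≫ u' = u ≫ h) (H₃ : h ≫ e' = e ≫ l) :
    F ≫ x' ≫ (u' ≫ e') ▷ B' = (x ≫ (u ≫ e) ▷ B) ≫ (l ⊗ₘ g) := by
  rw [reassoc_of% H₁, ← tensorHom_id, tensorHom_comp_tensorHom, reassoc_of% H₂, H₃,
    Category.assoc, ← tensorHom_id, tensorHom_comp_tensorHom, Category.comp_id, Category.id_comp,
    Category.assoc]

theorem tensPerm_natural : {n m : ℕ} → (σ : Fin n ≃ Fin m) → {X Y : Fin m → M} →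
    (f : ∀ i, X i ⟶ Y i) →
    tensMap f ≫ tensPerm σ Y = tensPerm σ X ≫ tensMap (fun j => f (σ j))
  | 0, 0, _, _, _, _ => (Category.id_comp _).trans (Category.comp_id _).symm
  | 0, _ + 1, σ, _, _, _ => (σ.symm 0).elim0
  | _ + 1, 0, σ, _, _, _ => (σ 0).elim0
  | n + 1, m + 1, σ, _, _, f =>
    perm_aux (extract_natural f (σ (Fin.last n)))
      (tensPerm_natural (removeLast σ) fun i => f ((σ (Fin.last n)).succAbove i))
      (tensMap_eqToHom f (succAbove_removeLast σ))

theorem unit_tensorμ : tensorμ (𝟙_ M) (𝟙_ M) (𝟙_ M) (𝟙_ M) ≫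
    ((λ_ (𝟙_ M)).hom ⊗ₘ (λ_ (𝟙_ M)).hom) = ((ρ_ (𝟙_ M)).hom ⊗ₘ (λ_ (𝟙_ M)).hom) := by
  simp only [tensorμ, braiding_tensorUnit_left]
  monoidal

theorem unit_swapLast : swapLast (𝟙_ M) (𝟙_ M) (𝟙_ M) = 𝟙 _ := by
  simp only [swapLast, braiding_tensorUnit_left]
  monoidal

theorem append_collapse_aux {P A B : M} {t : P ⟶ A ⊗ B} {a : A ⟶ 𝟙_ M} {b : B ⟶ 𝟙_ M}
    {c : P ⟶ 𝟙_ M} (H : t ≫ (a ⊗ₘ b) ≫ (λ_ (𝟙_ M)).hom = c) :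
    (t ▷ 𝟙_ M ≫ (α_ A B (𝟙_ M)).hom) ≫ (a ⊗ₘ (b ▷ 𝟙_ M ≫ (ρ_ (𝟙_ M)).hom)) ≫
      (λ_ (𝟙_ M)).hom = c ▷ 𝟙_ M ≫ (ρ_ (𝟙_ M)).hom := by
  subst H
  simp only [MonoidalCategory.tensorHom_def, Category.assoc, MonoidalCategory.comp_whiskerRight]
  congr 1
  simp only [← cancel_epi (α_ A B (𝟙_ M)).inv]
  monoidal

theorem append_zero_collapse_aux {A : M} (c : A ⟶ 𝟙_ M) :
    (ρ_ A).inv ≫ (c ⊗ₘ 𝟙 (𝟙_ M)) ≫ (λ_ (𝟙_ M)).hom = c := by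
  rw [← unitors_equal.symm]
  simp

theorem tensAppend_collapse (a : ℕ) : (b : ℕ) →
    tensAppend (fun _ : Fin (a + b) => 𝟙_ M) ≫ (collapse a ⊗ₘ collapse b) ≫ (λ_ (𝟙_ M)).hom =
      collapse (a + b)
  | 0 => append_zero_collapse_aux (collapse a)
  | b + 1 => append_collapse_aux (tensAppend_collapse a b)

theorem distrib_collapse_aux {X P B C Q : M} {t : P ⟶ B ⊗ C} {d : X ⊗ B ⟶ Q} {u : B ⟶ B}
    {w : C ⟶ C} {x : X ⟶ 𝟙_ M} {b : B ⟶ 𝟙_ M} {c : C ⟶ 𝟙_ M} {p : P ⟶ 𝟙_ M} {q q' : _}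
    (Hu : u = 𝟙 B) (Hw : w = 𝟙 C)
    (H₁ : t ≫ (b ⊗ₘ c) ≫ (λ_ (𝟙_ M)).hom = p)
    (H₂ : d ≫ (q : Q ⟶ 𝟙_ M) = (x ⊗ₘ b) ≫ (λ_ (𝟙_ M)).hom) (H₃ : q' = q) :
    ((X ⊗ 𝟙_ M) ◁ (t ≫ (u ⊗ₘ w)) ≫ tensorμ X (𝟙_ M) B C ≫ d ▷ (𝟙_ M ⊗ C)) ≫
      (q' ⊗ₘ ((λ_ C).hom ≫ c)) ≫ (ρ_ (𝟙_ M)).hom =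
      ((x ▷ 𝟙_ M ≫ (ρ_ (𝟙_ M)).hom) ⊗ₘ p) ≫ (λ_ (𝟙_ M)).hom := by
  subst Hu Hw H₁ H₃
  have e : (λ_ C).hom ≫ c = (𝟙 _ ⊗ₘ c) ≫ (λ_ (𝟙_ M)).hom := by simp
  rw [← tensorHom_id d, Category.assoc, Category.assoc, tensorHom_comp_tensorHom_assoc, H₂,
    Category.id_comp, e, ← tensorHom_comp_tensorHom_assoc, ← tensorμ_natural_assoc,
    reassoc_of% (unit_tensorμ (M := M)), ← id_tensorHom, tensorHom_comp_tensorHom_assoc,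
    tensorHom_comp_tensorHom_assoc, ← unitors_equal]
  simp

theorem distrib_zero_collapse_aux :
    (λ_ (𝟙_ M)).hom ≫ 𝟙 (𝟙_ M) ≫ 𝟙 (𝟙_ M) = (𝟙 (𝟙_ M) ⊗ₘ 𝟙 (𝟙_ M)) ≫ (λ_ (𝟙_ M)).hom := by
  simp

theorem distrib_collapse_aux' {X P B C Q Q' : M} {t : P ⟶ B ⊗ C} {d : X ⊗ B ⟶ Q} {u : B ⟶ B}
    {w : C ⟶ C} {x : X ⟶ 𝟙_ M} {b : B ⟶ 𝟙_ M} {c : C ⟶ 𝟙_ M} {p : P ⟶ 𝟙_ M} {q : Q ⟶ Q'}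
    {q' : Q' ⟶ 𝟙_ M} (Hu : u = 𝟙 B) (Hw : w = 𝟙 C)
    (H₁ : t ≫ (b ⊗ₘ c) ≫ (λ_ (𝟙_ M)).hom = p)
    (H₂ : d ≫ q ≫ q' = (x ⊗ₘ b) ≫ (λ_ (𝟙_ M)).hom) :
    ((X ⊗ 𝟙_ M) ◁ (t ≫ (u ⊗ₘ w)) ≫ tensorμ X (𝟙_ M) B C ≫ d ▷ (𝟙_ M ⊗ C)) ≫
      (q ⊗ₘ ((λ_ C).hom ≫ c)) ≫ q' ▷ 𝟙_ M ≫ (ρ_ (𝟙_ M)).hom =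
      ((x ▷ 𝟙_ M ≫ (ρ_ (𝟙_ M)).hom) ⊗ₘ p) ≫ (λ_ (𝟙_ M)).hom := by
  rw [← distrib_collapse_aux (q := q ≫ q') Hu Hw H₁ H₂ rfl, ← tensorHom_id q',
    tensorHom_comp_tensorHom_assoc, Category.comp_id]

theorem extract_zero_collapse_aux :
    (𝟙 (𝟙_ M) ⊗ₘ 𝟙 (𝟙_ M)) ≫ 𝟙 (𝟙_ M) ▷ 𝟙_ M ≫ (ρ_ (𝟙_ M)).hom =
      𝟙 (𝟙_ M) ▷ 𝟙_ M ≫ (ρ_ (𝟙_ M)).hom := by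
  simp

theorem extract_last_collapse_aux {A : M} {u : A ⟶ A} (Hu : u = 𝟙 A) {c : A ⟶ 𝟙_ M} :
    (u ⊗ₘ 𝟙 (𝟙_ M)) ≫ c ▷ 𝟙_ M ≫ (ρ_ (𝟙_ M)).hom = c ▷ 𝟙_ M ≫ (ρ_ (𝟙_ M)).hom := by
  simp [Hu]

theorem extract_cast_collapse_aux {P A : M} {x : P ⟶ A ⊗ 𝟙_ M} {u : A ⟶ A} {c : A ⟶ 𝟙_ M}
    {p : P ⟶ 𝟙_ M} (Hu : u = 𝟙 A) (H : x ≫ c ▷ 𝟙_ M ≫ (ρ_ (𝟙_ M)).hom = p) :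
    (x ▷ 𝟙_ M ≫ swapLast A (𝟙_ M) (𝟙_ M) ≫ (u ⊗ₘ 𝟙 (𝟙_ M)) ▷ 𝟙_ M) ≫
      (c ▷ 𝟙_ M ≫ (ρ_ (𝟙_ M)).hom) ▷ 𝟙_ M ≫ (ρ_ (𝟙_ M)).hom =
      p ▷ 𝟙_ M ≫ (ρ_ (𝟙_ M)).hom := by
  subst Hu H
  have h := swapLast_natural c (𝟙 (𝟙_ M)) (𝟙 (𝟙_ M))
  rw [unit_swapLast, Category.comp_id] at h
  simp only [tensorHom_id] at h
  rw [id_tensorHom_id, id_whiskerRight, Category.comp_id, MonoidalCategory.comp_whiskerRight,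
    Category.assoc, Category.assoc, ← reassoc_of% h]
  simp

theorem perm_collapse_aux {P A : M} {x : P ⟶ A ⊗ 𝟙_ M} {B : M} {s : A ⟶ B} {u : B ⟶ B}
    {c : A ⟶ 𝟙_ M} {c' : B ⟶ 𝟙_ M} {p : P ⟶ 𝟙_ M} (Hu : u = 𝟙 B) (Hs : s ≫ c' = c)
    (H : x ≫ c ▷ 𝟙_ M ≫ (ρ_ (𝟙_ M)).hom = p) :
    (x ≫ (s ≫ u) ▷ 𝟙_ M) ≫ c' ▷ 𝟙_ M ≫ (ρ_ (𝟙_ M)).hom = p := by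
  subst Hu Hs H
  simp

theorem tensMap_eqToHom_refl {n : ℕ} {X : Fin n → M} (h : ∀ i, X i = X i) :
    tensMap (fun i => eqToHom (h i)) = 𝟙 (tens X) := tensMap_id X

theorem distrib_collapse : {m : ℕ} → (k : Fin m → ℕ) →
    distrib (k := k) (fun _ : Fin m => 𝟙_ M) (fun _ _ => 𝟙_ M) ≫
      tensMap (fun i => (λ_ _).hom ≫ collapse (k i)) ≫ collapse m =
      (collapse m ⊗ₘ collapse (total k)) ≫ (λ_ (𝟙_ M)).hom
  | 0, _ => distrib_zero_collapse_aux
  | m + 1, k => distrib_collapse_aux' (tensMap_eqToHom_refl _) (tensMap_eqToHom_refl _)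
      (tensAppend_collapse _ _) (distrib_collapse fun i : Fin m => k i.castSucc)

theorem extract_collapse : {n : ℕ} → (k : Fin (n + 1)) →
    extract (fun _ : Fin (n + 1) => 𝟙_ M) k ≫ collapse (n + 1) = collapse (n + 1)
  | 0, k => extract_zero_collapse_aux
  | n + 1, k => by
    induction k using Fin.lastCases with
    | last =>
      rw [extract_last]
      exact extract_last_collapse_aux (tensMap_eqToHom_refl _)
    | cast k =>
      rw [extract_castSucc]
      exact extract_cast_collapse_aux (tensMap_eqToHom_refl _) (extract_collapse k)

theorem tensPerm_collapse : {n m : ℕ} → (σ : Fin n ≃ Fin m) →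
    tensPerm σ (fun _ => 𝟙_ M) ≫ collapse n = collapse m
  | 0, 0, _ => Category.id_comp _
  | 0, _ + 1, σ => (σ.symm 0).elim0
  | _ + 1, 0, σ => (σ 0).elim0
  | n + 1, m + 1, σ => perm_collapse_aux (tensMap_eqToHom_refl _)
      (tensPerm_collapse (removeLast σ)) (extract_collapse (σ (Fin.last n)))

end Tensor

/-! ### Copowers of the monoidal unit -/

section Copower

variable (M : Type u) [Category.{v} M] [MonoidalCategory M] [HasColimits M]

/-- The copower `S ⊗ I` of the monoidal unit by a set. -/
noncomputable def copower (S : Type v) : M := ∐ fun _ : S => 𝟙_ M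

/-- The coprojections of `S ⊗ I`. -/
noncomputable def copι {S : Type v} (s : S) : 𝟙_ M ⟶ copower M S := Sigma.ι (fun _ : S => 𝟙_ M) s

variable {M}

/-- Morphisms out of `S ⊗ I`. -/
noncomputable def copElim {S : Type v} {Y : M} (f : S → (𝟙_ M ⟶ Y)) : copower M S ⟶ Y :=
  Sigma.desc f

theorem copι_copElim {S : Type v} {Y : M} (f : S → (𝟙_ M ⟶ Y)) (s : S) :
    copι M s ≫ copElim f = f s := Sigma.ι_desc _ _

theorem copower_ext {S : Type v} {Y : M} {g g' : copower M S ⟶ Y}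
    (h : ∀ s, copι M s ≫ g = copι M s ≫ g') : g = g' := Sigma.hom_ext _ _ h

/-- The functoriality of `S ⊗ I` in the set `S`. -/
noncomputable def copMap {S T : Type v} (f : S → T) : copower M S ⟶ copower M T :=
  copElim fun s => copι M (f s)

theorem copι_copMap {S T : Type v} (f : S → T) (s : S) :
    copι M s ≫ copMap (M := M) f = copι M (f s) := copι_copElim _ _

variable [SymmetricCategory M] [MonoidalClosed M]

/-- The morphism `Z ⊗ (S ⊗ I) ⟶ Y` with components `f s : Z ⟶ Y`. -/
noncomputable def copDescRight {S : Type v} {Z Y : M} (f : S → (Z ⟶ Y)) : Z ⊗ copower M S ⟶ Y :=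
  MonoidalClosed.uncurry (copElim fun s => MonoidalClosed.curry ((ρ_ Z).hom ≫ f s))

theorem copDescRight_spec {S : Type v} {Z Y : M} (f : S → (Z ⟶ Y)) (s : S) :
    Z ◁ copι M s ≫ copDescRight f = (ρ_ Z).hom ≫ f s := by
  rw [copDescRight, ← MonoidalClosed.uncurry_natural_left, copι_copElim,
    MonoidalClosed.uncurry_curry]

/-- The morphism `(S ⊗ I) ⊗ Z ⟶ Y` with components `f s : Z ⟶ Y`. -/
noncomputable def copDesc {S : Type v} {Z Y : M} (f : S → (Z ⟶ Y)) : copower M S ⊗ Z ⟶ Y :=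
  (β_ _ _).hom ≫ copDescRight f

theorem copDesc_spec {S : Type v} {Z Y : M} (f : S → (Z ⟶ Y)) (s : S) :
    copι M s ▷ Z ≫ copDesc f = (λ_ Z).hom ≫ f s := by
  rw [copDesc, BraidedCategory.braiding_naturality_left_assoc, copDescRight_spec,
    braiding_tensorUnit_left]
  simp

/-- The morphism `(S_1 ⊗ I) ⊗ ⋯ ⊗ (S_n ⊗ I) ⟶ Y` with components `f (s_1, …, s_n) : I ⟶ Y`. -/
noncomputable def tensDesc {Y : M} : {n : ℕ} → {S : Fin n → Type v} →
    ((∀ i, S i) → (𝟙_ M ⟶ Y)) → (tens (fun i => copower M (S i)) ⟶ Y)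
  | 0, _, f => f (fun i => i.elim0)
  | _ + 1, S, f => copDescRight fun s => tensDesc fun q => f (Fin.snoc (α := S) q s)

/-- The coprojection of `(S_1 ⊗ I) ⊗ ⋯ ⊗ (S_n ⊗ I)` indexed by `(s_1, …, s_n)`. -/
noncomputable def tensι {n : ℕ} {S : Fin n → Type v} (s : ∀ i, S i) :
    tens (fun _ : Fin n => 𝟙_ M) ⟶ tens (fun i => copower M (S i)) :=
  tensMap fun i => copι M (s i)

theorem tensDesc_aux {A B U W Y : M} {u : A ⟶ B} {w : U ⟶ W} {z : B ⊗ W ⟶ Y} {r : B ⊗ U ⟶ B}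
    {r' : A ⊗ U ⟶ A} {d : B ⟶ Y} {e : A ⟶ Y} (h : B ◁ w ≫ z = r ≫ d)
    (hr : u ▷ U ≫ r = r' ≫ u) (h' : u ≫ d = e) : (u ⊗ₘ w) ≫ z = r' ≫ e := by
  rw [MonoidalCategory.tensorHom_def, Category.assoc, h, reassoc_of% hr, h']

theorem tensι_tensDesc {Y : M} : {n : ℕ} → {S : Fin n → Type v} →
    (f : (∀ i, S i) → (𝟙_ M ⟶ Y)) → (s : ∀ i, S i) →
    tensι s ≫ tensDesc f = collapse n ≫ f s
  | 0, _, f, s => congrArg (fun s => 𝟙 (𝟙_ M) ≫ f s) (funext fun i => i.elim0)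
  | n + 1, S, f, s => by
    refine (tensDesc_aux (copDescRight_spec _ (s (Fin.last n)))
      (rightUnitor_naturality _) (tensι_tensDesc _ fun i : Fin n => s i.castSucc)).trans ?_
    rw [← rightUnitor_naturality_assoc]
    refine Eq.trans ?_ (Category.assoc _ _ _).symm
    exact congrArg (fun s => collapse n ▷ 𝟙_ M ≫ (ρ_ (𝟙_ M)).hom ≫ f s) (Fin.snoc_init_self s)

/-- A jointly epimorphic family. -/
def JointEpi {J : Type*} {U : J → M} {V : M} (e : ∀ j, U j ⟶ V) : Prop :=
  ∀ ⦃Y : M⦄ (g g' : V ⟶ Y), (∀ j, e j ≫ g = e j ≫ g') → g = g'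

theorem jointEpi_copι (S : Type v) : JointEpi (fun s : S => copι M s) :=
  fun _ _ _ h => copower_ext h

theorem JointEpi.whiskerLeft {J : Type*} {U : J → M} {V : M} {e : ∀ j, U j ⟶ V}
    (h : JointEpi e) (Z : M) : JointEpi (fun j => Z ◁ e j) := fun Y g g' H => by
  refine MonoidalClosed.curry_injective (h _ _ fun j => ?_)
  rw [← MonoidalClosed.curry_natural_left, ← MonoidalClosed.curry_natural_left, H j]

theorem JointEpi.whiskerRight {J : Type*} {U : J → M} {V : M} {e : ∀ j, U j ⟶ V}
    (h : JointEpi e) (Z : M) : JointEpi (fun j => e j ▷ Z) := fun Y g g' H => by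
  rw [← cancel_epi (β_ Z V).hom]
  refine h.whiskerLeft Z _ _ fun j => ?_
  rw [BraidedCategory.braiding_naturality_right_assoc, H,
    BraidedCategory.braiding_naturality_right_assoc]

theorem JointEpi.tensor {J J' : Type*} {U : J → M} {V : M} {e : ∀ j, U j ⟶ V} (h : JointEpi e)
    {U' : J' → M} {V' : M} {e' : ∀ j, U' j ⟶ V'} (h' : JointEpi e') :
    JointEpi (fun j : J × J' => e j.1 ⊗ₘ e' j.2) := fun Y g g' H => by
  refine h'.whiskerLeft V _ _ fun j' => h.whiskerRight _ _ _ fun j => ?_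
  have H' : (e j ⊗ₘ e' j') ≫ g = (e j ⊗ₘ e' j') ≫ g' := H (j, j')
  rwa [MonoidalCategory.tensorHom_def, Category.assoc, Category.assoc] at H'

theorem jointEpi_tensι : {n : ℕ} → (S : Fin n → Type v) →
    JointEpi (fun s : ∀ i, S i => tensι (M := M) s)
  | 0, _ => fun _ g g' H => by
    have h := H fun i => i.elim0
    exact (Category.id_comp g).symm.trans (h.trans (Category.id_comp g'))
  | n + 1, S => fun _ g g' H => by
    refine (jointEpi_tensι fun i : Fin n => S i.castSucc).tensor (jointEpi_copι (S (Fin.last n)))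
      g g' fun j => ?_
    have h := H (Fin.snoc (α := S) j.1 j.2)
    have e : tensι (M := M) (Fin.snoc (α := S) j.1 j.2) =
        (tensι (M := M) j.1 ⊗ₘ copι M j.2) := by
      refine congrArg₂ (· ⊗ₘ ·) (congrArg tensMap (funext fun i => ?_)) ?_
      · exact congrArg (copι M) (Fin.snoc_castSucc (α := S) j.2 j.1 i)
      · exact congrArg (copι M) (Fin.snoc_last (α := S) j.2 j.1)
    exact (congrArg (· ≫ g) e).symm.trans (h.trans (congrArg (· ≫ g') e))

end Copower

/-! ### Colored operads and their algebras -/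

section Operad

variable (M : Type u) [Category.{v} M] [MonoidalCategory M] [SymmetricCategory M]

open Profile in
/-- A `K`-colored (symmetric) operad with values in a symmetric monoidal category `M`. -/
structure ColoredOperad (K : Type w) where
  /-- the objects of operations `O(t; c)` with the action of right permutations -/
  obj : K → Profile K ⥤ M
  /-- the operadic units -/
  one : ∀ t : K, 𝟙_ M ⟶ (obj t).obj (single t)
  /-- the operadic composition
  `γ : O(t; a) ⊗ (O(a_1; b_1) ⊗ ⋯ ⊗ O(a_m; b_m)) ⟶ O(t; b_1 ⊗ ⋯ ⊗ b_m)` -/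
  comp : ∀ (t : K) (a : Profile K) (b : Fin a.len → Profile K),
    (obj t).obj a ⊗ tens (fun i => (obj (a.color i)).obj (b i)) ⟶ (obj t).obj (concat b)
  /-- first equivariance axiom -/
  comp_perm : ∀ (t : K) (a : Profile K) (b : Fin a.len → Profile K) {n : ℕ}
    (σ : Fin n ≃ Fin a.len),
    ((obj t).map (a.reindexHom σ) ⊗ₘ tensPerm σ (fun i => (obj (a.color i)).obj (b i))) ≫
      comp t (a.reindex σ) (fun j => b (σ j)) = comp t a b ≫ (obj t).map (blockPerm b σ)
  /-- second equivariance axiom -/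
  comp_map : ∀ (t : K) (a : Profile K) (b b' : Fin a.len → Profile K) (σ : ∀ i, b i ⟶ b' i),
    (obj t).obj a ◁ tensMap (fun i => (obj (a.color i)).map (σ i)) ≫ comp t a b' =
      comp t a b ≫ (obj t).map (blockSum σ)
  /-- associativity -/
  assoc : ∀ (t : K) (a : Profile K) (b : Fin a.len → Profile K)
    (c : ∀ i, Fin (b i).len → Profile K),
    comp t a b ▷ tens (fun x : Fin (concat b).len =>
        (obj ((concat b).color x)).obj (flat b c x)) ≫
      comp t (concat b) (flat b c) ≫ (obj t).map (concatAssoc b c) =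
    (α_ _ _ _).hom ≫ (obj t).obj a ◁
      (distrib (fun i => (obj (a.color i)).obj (b i))
        (fun i j => (obj ((b i).color j)).obj (c i j)) ≫
        tensMap (fun i => comp (a.color i) (b i) (c i))) ≫
      comp t a (fun i => concat (c i))
  /-- unitality -/
  comp_one : ∀ (t : K) (a : Profile K),
    (obj t).obj a ◁ tensMap (fun i => one (a.color i)) ≫
      comp t a (fun i => single (a.color i)) =
    (obj t).obj a ◁ collapse a.len ≫ (ρ_ _).hom ≫ (obj t).map (concatSingle a)
  /-- unitality -/
  one_comp : ∀ (t : K) (a : Profile K),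
    one t ▷ tens (fun _ : Fin 1 => (obj t).obj a) ≫ comp t (single t) (fun _ => a) =
    (λ_ _).hom ≫ tensOne (fun _ => (obj t).obj a) ≫ (obj t).map (concatOne t a)

variable {M}

/-- A morphism of operads with varying colors. -/
structure ColoredOperad.Hom {K : Type*} {L : Type*} (O : ColoredOperad M K)
    (P : ColoredOperad M L) where
  /-- the map of colors -/
  color : K → L
  /-- the components `O(t; c) ⟶ P(f t; f c)` -/
  app : ∀ (t : K) (c : Profile K), (O.obj t).obj c ⟶ (P.obj (color t)).obj (c.map color)
  naturality : ∀ (t : K) {c d : Profile K} (h : c ⟶ d),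
    (O.obj t).map h ≫ app t d = app t c ≫ (P.obj (color t)).map (Profile.mapHom color h)
  one_app : ∀ t : K, O.one t ≫ app t (Profile.single t) = P.one (color t)
  comp_app : ∀ (t : K) (a : Profile K) (b : Fin a.len → Profile K),
    O.comp t a b ≫ app t (Profile.concat b) =
      (app t a ⊗ₘ tensMap (fun i => app (a.color i) (b i))) ≫
        P.comp (color t) (a.map color) (fun i => (b i).map color)

/-- An algebra over a colored operad. -/
structure OperadAlgebra {K : Type w} (O : ColoredOperad M K) where
  /-- the objects `A_t` -/
  carrier : K → M
  /-- the structure morphisms `α : O(t; c) ⊗ (A_{c_1} ⊗ ⋯ ⊗ A_{c_n}) ⟶ A_t` -/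
  act : ∀ (t : K) (c : Profile K),
    (O.obj t).obj c ⊗ tens (fun i => carrier (c.color i)) ⟶ carrier t
  /-- equivariance -/
  act_perm : ∀ (t : K) (c : Profile K) {n : ℕ} (σ : Fin n ≃ Fin c.len),
    ((O.obj t).map (c.reindexHom σ) ⊗ₘ tensPerm σ (fun i => carrier (c.color i))) ≫
      act t (c.reindex σ) = act t c
  /-- unitality -/
  act_one : ∀ t : K, O.one t ▷ tens (fun _ : Fin 1 => carrier t) ≫ act t (Profile.single t) =
    (λ_ _).hom ≫ tensOne (fun _ => carrier t)
  /-- associativity -/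
  act_comp : ∀ (t : K) (a : Profile K) (b : Fin a.len → Profile K),
    O.comp t a b ▷ tens (fun x => carrier ((Profile.concat b).color x)) ≫
      act t (Profile.concat b) =
    (α_ _ _ _).hom ≫ (O.obj t).obj a ◁
      (distrib (fun i => (O.obj (a.color i)).obj (b i)) (fun i j => carrier ((b i).color j)) ≫
        tensMap (fun i => act (a.color i) (b i))) ≫ act t a

namespace OperadAlgebra

/-- A morphism of algebras over a colored operad. -/
@[ext] structure Hom {K : Type w} {O : ColoredOperad M K} (A B : OperadAlgebra O) where
  /-- the components -/
  app : ∀ t, A.carrier t ⟶ B.carrier t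
  act_app : ∀ (t : K) (c : Profile K), A.act t c ≫ app t =
    (O.obj t).obj c ◁ tensMap (fun i => app (c.color i)) ≫ B.act t c

/-- The category of algebras over a colored operad. -/
instance {K : Type w} (O : ColoredOperad M K) : Category (OperadAlgebra O) where
  Hom := Hom
  id A := ⟨fun t => 𝟙 _, fun t c => by simp [tensMap_id]⟩
  comp f g := ⟨fun t => f.app t ≫ g.app t, fun t c => by
    rw [reassoc_of% f.act_app t c, g.act_app, ← tensMap_comp, MonoidalCategory.whiskerLeft_comp,
      Category.assoc]⟩

theorem pullback_perm_aux {X X' Y Y' T T' Z : M} {a : X ⟶ X'} {n : X' ⟶ Y'} {n' : X ⟶ Y}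
    {a' : Y ⟶ Y'} {s : T ⟶ T'} {β : Y ⊗ T ⟶ Z} {β' : Y' ⊗ T' ⟶ Z} (H : a ≫ n = n' ≫ a')
    (h : (a' ⊗ₘ s) ≫ β' = β) : (a ⊗ₘ s) ≫ n ▷ T' ≫ β' = n' ▷ T ≫ β := by
  rw [← h, ← tensorHom_id, ← tensorHom_id, tensorHom_comp_tensorHom_assoc,
    tensorHom_comp_tensorHom_assoc, H, Category.comp_id, Category.id_comp]

theorem pullback_one_aux {X Y T Z : M} {e : 𝟙_ M ⟶ X} {n : X ⟶ Y} {e' : 𝟙_ M ⟶ Y}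
    {β : Y ⊗ T ⟶ Z} {r : 𝟙_ M ⊗ T ⟶ Z} (H : e ≫ n = e') (h : e' ▷ T ≫ β = r) :
    e ▷ T ≫ n ▷ T ≫ β = r := by
  rw [← h, ← H, MonoidalCategory.comp_whiskerRight, Category.assoc]

theorem pullback_comp_aux {X X' Y Y' T Z Z' A B B' C : M} {γ : X ⊗ A ⟶ Z} {n : Z ⟶ Z'}
    {n₁ : X ⟶ X'} {n₂ : A ⟶ Y} {γ' : X' ⊗ Y ⟶ Z'} {β : Z' ⊗ T ⟶ C} {d : A ⊗ T ⟶ B}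
    {d' : Y ⊗ T ⟶ B'} {l : B ⟶ B'} {r : B' ⟶ Y'} {r' : B ⟶ Y'} {β' : X' ⊗ Y' ⟶ C}
    (H : γ ≫ n = (n₁ ⊗ₘ n₂) ≫ γ')
    (h : γ' ▷ T ≫ β = (α_ _ _ _).hom ≫ X' ◁ (d' ≫ r) ≫ β') (h' : n₂ ▷ T ≫ d' = d ≫ l)
    (hr : l ≫ r = r') :
    γ ▷ T ≫ n ▷ T ≫ β = (α_ _ _ _).hom ≫ X ◁ (d ≫ r') ≫ n₁ ▷ Y' ≫ β' := by
  rw [← MonoidalCategory.comp_whiskerRight_assoc, H, MonoidalCategory.comp_whiskerRight_assoc, h,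
    ← hr, ← reassoc_of% h', ← tensorHom_id (n₁ ⊗ₘ n₂), associator_naturality_assoc, ← id_tensorHom,
    tensorHom_comp_tensorHom_assoc, ← tensorHom_id n₁, ← id_tensorHom,
    tensorHom_comp_tensorHom_assoc, tensorHom_id n₂]
  simp only [Category.comp_id, Category.id_comp]

theorem pullback_map_aux {X Y T T' Z Z' : M} {n : X ⟶ Y} {β : Y ⊗ T ⟶ Z} {g : Z ⟶ Z'}
    {s : T ⟶ T'} {β' : Y ⊗ T' ⟶ Z'} (h : β ≫ g = Y ◁ s ≫ β') :
    (n ▷ T ≫ β) ≫ g = X ◁ s ≫ n ▷ T' ≫ β' := by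
  rw [Category.assoc, h, ← whisker_exchange_assoc]

theorem distrib_whiskerRight {m : ℕ} {k : Fin m → ℕ} {X Y : Fin m → M}
    (W : ∀ i, Fin (k i) → M) (f : ∀ i, X i ⟶ Y i) :
    tensMap f ▷ tens (fun p => W (locate k p).1 (locate k p).2) ≫ distrib Y W =
      distrib X W ≫ tensMap (fun i => f i ▷ tens (W i)) := by
  have h := distrib_natural f (fun i j => 𝟙 (W i j))
  simp only [tensMap_id, tensorHom_id] at h
  exact h

/-- The pullback `f^* : Alg(P) ⟶ Alg(O)` along a morphism of operads `f : O ⟶ P`. -/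
def pullback {K : Type*} {L : Type*} {O : ColoredOperad M K} {P : ColoredOperad M L}
    (f : O.Hom P) : OperadAlgebra P ⥤ OperadAlgebra O where
  obj B :=
    { carrier := fun t => B.carrier (f.color t)
      act := fun t c => f.app t c ▷ _ ≫ B.act (f.color t) (c.map f.color)
      act_perm := fun t c n σ => pullback_perm_aux (f.naturality t (c.reindexHom σ))
        (B.act_perm (f.color t) (c.map f.color) σ)
      act_one := fun t => pullback_one_aux (f.one_app t) (B.act_one (f.color t))
      act_comp := fun t a b => pullback_comp_aux (f.comp_app t a b)
        (B.act_comp (f.color t) (a.map f.color) (fun i => (b i).map f.color))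
        (distrib_whiskerRight (fun i j => B.carrier (f.color ((b i).color j))) _)
        (tensMap_comp _ _) }
  map g := ⟨fun t => g.app (f.color t),
    fun t c => pullback_map_aux (g.act_app (f.color t) (c.map f.color))⟩
  map_id _ := rfl
  map_comp _ _ := rfl

end OperadAlgebra

end Operad

/-! ### The operad in `M` determined by an operad in sets -/

section BaseChange

variable {M : Type u} [Category.{v} M] [MonoidalCategory M] [SymmetricCategory M]
  [MonoidalClosed M] [HasColimits M]

theorem tensMap_copMap {n : ℕ} {S T : Fin n → Type v} (f : ∀ i, S i → T i) (s : ∀ i, S i) :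
    tensι s ≫ tensMap (fun i => copMap (M := M) (f i)) = tensι fun i => f i (s i) :=
  (tensMap_comp _ _).trans (congrArg tensMap (funext fun i => copι_copMap (f i) (s i)))

/-- The morphism `(S ⊗ I) ⊗ ((Q_1 ⊗ I) ⊗ ⋯ ⊗ (Q_n ⊗ I)) ⟶ T ⊗ I` determined by a map of sets
`S × Q_1 × ⋯ × Q_n → T`. -/
noncomputable def copComp {S T : Type v} {n : ℕ} {Q : Fin n → Type v} (f : S → (∀ i, Q i) → T) :
    copower M S ⊗ tens (fun i => copower M (Q i)) ⟶ copower M T :=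
  copDesc fun p => tensDesc fun q => copι M (f p q)

theorem copComp_spec {S T : Type v} {n : ℕ} {Q : Fin n → Type v} (f : S → (∀ i, Q i) → T)
    (p : S) (q : ∀ i, Q i) :
    (copι M p ⊗ₘ tensι q) ≫ copComp f = (λ_ _).hom ≫ collapse n ≫ copι M (f p q) := by
  rw [tensorHom_def', Category.assoc, copComp, copDesc_spec, leftUnitor_naturality_assoc,
    tensι_tensDesc]

theorem copComp_ext {S Y} {n : ℕ} {Q : Fin n → Type v}
    {g g' : copower M S ⊗ tens (fun i => copower M (Q i)) ⟶ Y}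
    (h : ∀ p q, (copι M p ⊗ₘ tensι q) ≫ g = (copι M p ⊗ₘ tensι q) ≫ g') : g = g' :=
  (jointEpi_copι S).tensor (jointEpi_tensι Q) g g' fun j => h j.1 j.2

theorem copComp_perm_aux {X X' T T' Z I₁ J J' : M} {x : I₁ ⟶ X} {t : J ⟶ T} {a : X ⟶ X'}
    {x' : I₁ ⟶ X'} {s : T ⟶ T'} {s₀ : J ⟶ J'} {t' : J' ⟶ T'} {γ : X' ⊗ T' ⟶ Z} {r : I₁ ⊗ J' ⟶ Z}
    (h₁ : x ≫ a = x') (h₂ : t ≫ s = s₀ ≫ t') (h : (x' ⊗ₘ t') ≫ γ = r) :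
    (x ⊗ₘ t) ≫ (a ⊗ₘ s) ≫ γ = I₁ ◁ s₀ ≫ r := by
  rw [← h, tensorHom_comp_tensorHom_assoc, h₁, h₂, ← id_tensorHom, tensorHom_comp_tensorHom_assoc,
    Category.id_comp]

theorem copComp_perm {S S' T T' : Type v} {n n' : ℕ} {Q : Fin n → Type v}
    (f : S → (∀ i, Q i) → T) (σ : Fin n' ≃ Fin n) (f' : S' → (∀ j, Q (σ j)) → T')
    (u : S → S') (w : T → T') (H : ∀ p q, f' (u p) (fun j => q (σ j)) = w (f p q)) :
    (copMap u ⊗ₘ tensPerm σ (fun i => copower M (Q i))) ≫ copComp f' =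
      copComp f ≫ copMap w := by
  refine copComp_ext fun p q => ?_
  rw [← Category.assoc _ (copComp f), copComp_spec, Category.assoc, Category.assoc, copι_copMap]
  refine (copComp_perm_aux (copι_copMap u p) (tensPerm_natural σ fun i => copι M (q i))
    (copComp_spec f' (u p) fun j => q (σ j))).trans ?_
  rw [leftUnitor_naturality_assoc, ← Category.assoc _ (collapse n'), tensPerm_collapse, H]

theorem copComp_map {S T T' : Type v} {n : ℕ} {Q Q' : Fin n → Type v}
    (f : S → (∀ i, Q i) → T) (f' : S → (∀ i, Q' i) → T') (u : ∀ i, Q i → Q' i) (w : T → T')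
    (H : ∀ p q, f' p (fun i => u i (q i)) = w (f p q)) :
    copower M S ◁ tensMap (fun i => copMap (u i)) ≫ copComp f' = copComp f ≫ copMap w := by
  refine copComp_ext fun p q => ?_
  rw [← Category.assoc _ (copComp f), copComp_spec, Category.assoc, Category.assoc, copι_copMap,
    ← id_tensorHom, tensorHom_comp_tensorHom_assoc, tensMap_copMap, Category.comp_id,
    copComp_spec, H]

theorem copComp_one {S T : Type v} {n : ℕ} {Q : Fin n → Type v} (f : S → (∀ i, Q i) → T)
    (q : ∀ i, Q i) (w : S → T) (H : ∀ p, f p q = w p) :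
    copower M S ◁ tensι q ≫ copComp f = copower M S ◁ collapse n ≫ (ρ_ _).hom ≫ copMap w := by
  refine (jointEpi_copι S).whiskerRight _ _ _ fun p => ?_
  have h := copComp_spec (M := M) f p q
  rw [MonoidalCategory.tensorHom_def, Category.assoc] at h
  refine h.trans ?_
  rw [H, ← whisker_exchange_assoc, rightUnitor_naturality_assoc, copι_copMap, ← unitors_equal,
    leftUnitor_naturality_assoc]

theorem copComp_unit_aux {Q T : M} {c : 𝟙_ M ⟶ Q} {m : Q ⟶ T} {c' : 𝟙_ M ⟶ T} (h : c ≫ m = c') :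
    (𝟙 (𝟙_ M) ▷ 𝟙_ M ≫ (ρ_ (𝟙_ M)).hom) ≫ c' = (𝟙 (𝟙_ M) ⊗ₘ c) ≫ (λ_ Q).hom ≫ m := by
  rw [← h, ← unitors_equal]
  simp

theorem copComp_unit {S T Q : Type v} (f : S → (Fin 1 → Q) → T) (p : S) (w : Q → T)
    (H : ∀ q, f p (fun _ => q) = w q) :
    copι M p ▷ tens (fun _ : Fin 1 => copower M Q) ≫ copComp f =
      (λ_ _).hom ≫ tensOne (fun _ => copower M Q) ≫ copMap w := by
  refine (jointEpi_tensι fun _ : Fin 1 => Q).whiskerLeft _ _ _ fun q => ?_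
  obtain ⟨q, rfl⟩ : ∃ q', q = fun _ => q' := ⟨q 0, funext fun i => by rw [Subsingleton.elim i 0]⟩
  have h := copComp_spec (M := M) f p (fun _ => q)
  rw [tensorHom_def', Category.assoc] at h
  refine h.trans ?_
  rw [H, leftUnitor_naturality_assoc]
  exact congrArg (_ ≫ ·) (copComp_unit_aux (copι_copMap w q))

theorem locate_surjective {m : ℕ} {k : Fin m → ℕ} {R : (Σ i, Fin (k i)) → Type v}
    (r : ∀ x, R (locate k x)) : ∃ r' : ∀ i j, R ⟨i, j⟩,
      (fun x => r' (locate k x).1 (locate k x).2) = r :=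
  ⟨fun i j => Equiv.piCongrLeft R (blocks k).symm r ⟨i, j⟩,
    funext fun x => Equiv.piCongrLeft_apply_apply R (blocks k).symm r x⟩

theorem copComp_assoc_aux {X T U V W W' Z Z' J L L' N : M} {x : 𝟙_ M ⟶ X} {t : J ⟶ T}
    {u : L ⟶ U} {γ₁ : X ⊗ T ⟶ V} {z : 𝟙_ M ⟶ V} {c : J ⟶ 𝟙_ M}
    {γ₂ : V ⊗ U ⟶ W} {w : 𝟙_ M ⟶ W} {c' : L ⟶ 𝟙_ M} {m : W ⟶ W'} {w' : 𝟙_ M ⟶ W'}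
    {d : T ⊗ U ⟶ Z} {d₀ : J ⊗ L ⟶ N} {s : N ⟶ Z} {k : Z ⟶ Z'} {s' : N ⟶ L'} {k' : L' ⟶ Z'}
    {c'' : L' ⟶ 𝟙_ M} {γ₃ : X ⊗ Z' ⟶ W'}
    (h₁ : (x ⊗ₘ t) ≫ γ₁ = (λ_ J).hom ≫ c ≫ z) (h₂ : (z ⊗ₘ u) ≫ γ₂ = (λ_ L).hom ≫ c' ≫ w)
    (h₃ : w ≫ m = w') (h₄ : (t ⊗ₘ u) ≫ d = d₀ ≫ s) (h₅ : s ≫ k = s' ≫ k')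
    (h₆ : (x ⊗ₘ k') ≫ γ₃ = (λ_ L').hom ≫ c'' ≫ w')
    (h₇ : d₀ ≫ s' ≫ c'' = (c ⊗ₘ c') ≫ (λ_ (𝟙_ M)).hom) :
    ((x ⊗ₘ t) ⊗ₘ u) ≫ γ₁ ▷ U ≫ γ₂ ≫ m =
      ((x ⊗ₘ t) ⊗ₘ u) ≫ (α_ _ _ _).hom ≫ X ◁ (d ≫ k) ≫ γ₃ := by
  have e₁ : ((x ⊗ₘ t) ⊗ₘ u) ≫ γ₁ ▷ U ≫ γ₂ ≫ m =
      ((λ_ J).hom ≫ c) ▷ L ≫ (z ⊗ₘ u) ≫ γ₂ ≫ m := by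
    rw [← tensorHom_id, tensorHom_comp_tensorHom_assoc, h₁, Category.comp_id, ← tensorHom_id,
      tensorHom_comp_tensorHom_assoc, Category.id_comp, Category.assoc]
  have e₂ : (t ⊗ₘ u) ≫ d ≫ k = (d₀ ≫ s') ≫ k' := by
    rw [reassoc_of% h₄, h₅, Category.assoc]
  have e₃ : ((x ⊗ₘ t) ⊗ₘ u) ≫ (α_ _ _ _).hom ≫ X ◁ (d ≫ k) ≫ γ₃ =
      (α_ _ _ _).hom ≫ 𝟙_ M ◁ (d₀ ≫ s') ≫ (x ⊗ₘ k') ≫ γ₃ := by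
    rw [associator_naturality_assoc, ← id_tensorHom, tensorHom_comp_tensorHom_assoc, e₂,
      ← id_tensorHom, tensorHom_comp_tensorHom_assoc, Category.comp_id, Category.id_comp]
  rw [e₁, e₃, reassoc_of% h₂, h₃, h₆, leftUnitor_naturality_assoc, Category.assoc, reassoc_of% h₇,
    MonoidalCategory.tensorHom_def, Category.assoc, ← leftUnitor_naturality_assoc c',
    MonoidalCategory.comp_whiskerRight, Category.assoc, leftUnitor_whiskerRight, Category.assoc]

theorem copComp_assoc {S T T' V : Type v} {m : ℕ} {k : Fin m → ℕ} {Q Q' : Fin m → Type v}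
    {R : ∀ i, Fin (k i) → Type v} (f : S → (∀ i, Q i) → V)
    (g : V → (∀ x, R (locate k x).1 (locate k x).2) → T) (w : T → T')
    (f' : ∀ i, Q i → (∀ j, R i j) → Q' i) (g' : S → (∀ i, Q' i) → T')
    (H : ∀ p q (r : ∀ i j, R i j), w (g (f p q) fun x => r (locate k x).1 (locate k x).2) =
      g' p fun i => f' i (q i) (r i)) :
    copComp f ▷ tens (fun x => copower M (R (locate k x).1 (locate k x).2)) ≫ copComp g ≫
        copMap w =
      (α_ _ _ _).hom ≫ copower M S ◁ (distrib (fun i => copower M (Q i))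
        (fun i j => copower M (R i j)) ≫ tensMap (fun i => copComp (f' i))) ≫ copComp g' := by
  refine ((jointEpi_copι S).tensor (jointEpi_tensι Q)).tensor
    (jointEpi_tensι fun x => R (locate k x).1 (locate k x).2) _ _ fun ⟨⟨p, q⟩, r⟩ => ?_
  obtain ⟨r, rfl⟩ := locate_surjective (R := fun x => R x.1 x.2) r
  refine copComp_assoc_aux (copComp_spec f p q) (copComp_spec g (f p q) _)
    ((copι_copMap w _).trans (congrArg _ (H p q r)))
    (distrib_natural (fun i => copι M (q i)) fun i j => copι M (r i j))
    (s' := tensMap fun i => (λ_ _).hom ≫ collapse (k i))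
    (k' := tensι fun i => f' i (q i) (r i)) ?_ (copComp_spec g' p _) (distrib_collapse k)
  refine (tensMap_comp _ _).trans (Eq.trans ?_ (tensMap_comp _ _).symm)
  refine congrArg tensMap (funext fun i => ?_)
  exact (copComp_spec (f' i) (q i) (r i)).trans (Category.assoc _ _ _).symm

/-- The operad `P ⊗ I` with values in `M` determined by an operad `P` in sets: its objects of
operations are the copowers `P(t; c) ⊗ I`. -/
noncomputable def SetOperad.baseChange (M : Type u) [Category.{v} M] [MonoidalCategory M]
    [SymmetricCategory M] [MonoidalClosed M] [HasColimits M] {K : Type w}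
    (P : SetOperad.{w, v} K) : ColoredOperad M K where
  obj t :=
    { obj := fun c => copower M (P.obj c t)
      map := fun h => copMap (P.map h)
      map_id := fun c => copower_ext fun s => by rw [copι_copMap, P.map_id, Category.comp_id]
      map_comp := fun g h => copower_ext fun s => by
        rw [copι_copMap, P.map_comp, ← Category.assoc, copι_copMap, copι_copMap] }
  one t := copι M (P.one t)
  comp t a b := copComp fun p q => P.comp b p q
  comp_perm t a b n σ := copComp_perm _ σ _ _ _ fun p q => P.comp_perm b p q σ
  comp_map t a b b' σ := copComp_map _ _ _ _ fun p q => P.comp_map b b' p q σ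
  assoc t a b c := copComp_assoc _ _ _ _ _ fun p q r => P.assoc b c p q r
  comp_one t a := copComp_one _ _ _ fun p => P.comp_one p
  one_comp t a := copComp_unit _ _ _ fun p => P.one_comp p

theorem copMap_comm {S T T' V : Type v} (f : S → T) (g : T → V) (f' : S → T') (g' : T' → V)
    (H : ∀ s, g (f s) = g' (f' s)) :
    copMap (M := M) f ≫ copMap g = copMap f' ≫ copMap g' := copower_ext fun s => by
  rw [← Category.assoc, copι_copMap, copι_copMap, ← Category.assoc, copι_copMap, copι_copMap, H]

theorem copComp_hom {S S' T T' : Type v} {n : ℕ} {Q Q' : Fin n → Type v}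
    (f : S → (∀ i, Q i) → T) (f' : S' → (∀ i, Q' i) → T') (w : T → T') (v : S → S')
    (u : ∀ i, Q i → Q' i) (H : ∀ p q, w (f p q) = f' (v p) (fun i => u i (q i))) :
    copComp f ≫ copMap (M := M) w =
      (copMap v ⊗ₘ tensMap (fun i => copMap (u i))) ≫ copComp f' := by
  refine copComp_ext fun p q => ?_
  rw [← Category.assoc _ (copComp f), copComp_spec, Category.assoc, Category.assoc, copι_copMap,
    tensorHom_comp_tensorHom_assoc, tensMap_copMap, copι_copMap, copComp_spec, H]

/-- The morphism of operads with values in `M` determined by a morphism of operads in sets. -/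
noncomputable def SetOperad.Hom.baseChange (M : Type u) [Category.{v} M] [MonoidalCategory M]
    [SymmetricCategory M] [MonoidalClosed M] [HasColimits M] {K : Type*} {L : Type*}
    {P : SetOperad.{_, v} K} {Q : SetOperad.{_, v} L} (f : P.Hom Q) :
    (P.baseChange M).Hom (Q.baseChange M) where
  color := f.color
  app t c := copMap f.app
  naturality t c d h := copMap_comm _ _ _ _ fun p => f.app_map h p
  one_app t := (copι_copMap _ _).trans (congrArg (copι M) (f.app_one t))
  comp_app t a b := copComp_hom _ _ _ _ _ fun p q => f.app_comp b p q

end BaseChange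

/-! ### Algebras over the operads of orthogonal categories -/

section QFT

variable (M : Type u) [Category.{v} M] [MonoidalCategory M] [SymmetricCategory M]
  [MonoidalClosed M] [HasColimits M]

/-- The category `Alg(O_(C, ⊥))` of `M`-valued quantum field theories on the orthogonal category
`(C, ⊥)`. -/
abbrev QFT {C : Type w} [Category.{v} C] (R : Orthogonality C) :=
  OperadAlgebra ((orthOperad R).baseChange M)

/-- The pullback functor `O_F^* : Alg(O_(D, ⊥_D)) ⟶ Alg(O_(C, ⊥_C))`. -/
noncomputable def qftPullback {C : Type w} [Category.{v} C] {D : Type w} [Category.{v} D]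
    {R : Orthogonality C} {S : Orthogonality D} (F : OrthFunctor R S) : QFT M S ⥤ QFT M R :=
  OperadAlgebra.pullback ((orthOperadHom F).baseChange M)

end QFT

end OrthQFT

universe w' w v u

open OrthQFT

/-! The assignment `F ↦ qftPullback M F` is a contravariant pseudofunctor: it respects identities
and composites up to isomorphism (`qftPullbackId`, `qftPullbackComp`), and a natural isomorphism `F
≅ G` of underlying functors induces `qftPullback M F ≅ qftPullback M G` (`qftPullbackIso`). An
orthogonal equivalence has an orthogonal quasi-inverse, because `F^*(⊥_D) = ⊥_C` makes `F` reflect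
orthogonality and orthogonality is invariant under natural isomorphism (`OrthFunctor.lift`). Pulling
back along the quasi-inverse therefore inverts `qftPullback M F` up to isomorphism. An equivalence
has a left adjoint, and every left adjoint of an equivalence is itself an equivalence, with
invertible unit and counit. For two small models `I` and `J` of one orthogonal category, the
comparison functor is `J⁻¹ ∘ I`.

The substance lies in `qftPullbackIso`. Given `α : F ≅ G` and an algebra `B`, the component at `t`
is the action on `B` of the unary operation `[e, α_t]`. Compatibility with an operation `[σ, f]`
reads: acting by `[σ, F f]` and then by `α_t` is acting by `[σ, F f_i ≫ α_t] = [σ, α_{c_i} ≫ G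
f_i]`, which is acting by the `α_{c_i}` in each factor and then by `[σ, G f]`. The middle equality
is naturality of `α`; the outer two are `opAct_unary_ofHom` and `unary_ofHom_opAct`.

Such elementwise arguments are legitimate because the coprojections of a copower remain jointly
epimorphic after tensoring, so an algebra is controlled by the actions `opAct` of single operations.
The associativity axiom expresses the action of a composite only up to insertions of unit objects
and shuffles of factors. These are never computed by coherence: the same expression with an operadic
unit in place of the unary operation shows that they have no effect (`opAct_unary`, `unary_opAct`).
-/

namespace OrthQFT

/-! ### Unit factors in tensor products, and algebras through the actions of single operations -/

section Elementwise

variable {M : Type u} [Category.{v} M] [MonoidalCategory M]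

/-- The morphism is built from unitors alone. Its inverse creates the factors `I` on which the inner
operations of an operadic composite are inserted. -/
instance isIso_collapse : (n : ℕ) → IsIso (collapse (M := M) n)
  | 0 => inferInstanceAs (IsIso (𝟙 (𝟙_ M)))
  | n + 1 => by
    have := isIso_collapse n
    exact inferInstanceAs (IsIso (collapse n ▷ 𝟙_ M ≫ (ρ_ (𝟙_ M)).hom))

/-- Insertion of tensor factors `I`. -/
noncomputable def insertUnits (n : ℕ) (Z : M) : Z ⟶ tens (fun _ : Fin n => 𝟙_ M) ⊗ Z :=
  (λ_ Z).inv ≫ inv (collapse n) ▷ Z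

theorem insertUnits_collapse (n : ℕ) (Z : M) :
    insertUnits n Z ≫ collapse n ▷ Z ≫ (λ_ Z).hom = 𝟙 Z := by
  rw [insertUnits, Category.assoc, ← MonoidalCategory.comp_whiskerRight_assoc, IsIso.inv_hom_id,
    id_whiskerRight, Category.id_comp, Iso.inv_hom_id]

theorem insertUnits_natural (n : ℕ) {Z Z' : M} (f : Z ⟶ Z') :
    f ≫ insertUnits n Z' = insertUnits n Z ≫ _ ◁ f := by
  rw [insertUnits, insertUnits, leftUnitor_inv_naturality_assoc, whisker_exchange, Category.assoc]

theorem opAct_map_aux {X Y T T' Z : M} {x : 𝟙_ M ⟶ X} {n : X ⟶ Y} {y : 𝟙_ M ⟶ Y} {s : T ⟶ T'}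
    {β : Y ⊗ T' ⟶ Z} {β' : X ⊗ T ⟶ Z} (h : (n ⊗ₘ s) ≫ β = β') (hx : x ≫ n = y) :
    s ≫ (λ_ T').inv ≫ y ▷ T' ≫ β = (λ_ T).inv ≫ x ▷ T ≫ β' := by
  subst h hx
  rw [leftUnitor_inv_naturality_assoc, ← id_tensorHom, ← tensorHom_id, ← tensorHom_id,
    tensorHom_comp_tensorHom_assoc, tensorHom_comp_tensorHom_assoc]
  simp only [Category.comp_id, Category.id_comp]

/-- The diagram chase behind `opAct_comp`, with objects and morphisms abstracted. `H` is the
associativity axiom of an algebra, `x` picks the outer operation, `t` the inner ones and `z` their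
composite; `b` and `b'` are the resulting actions. -/
theorem opAct_comp_aux {X T Y V W Z C D B : M} {x : 𝟙_ M ⟶ X} {t : D ⟶ T} {s : D ⟶ 𝟙_ M}
    {z : 𝟙_ M ⟶ Z} {γ : X ⊗ T ⟶ Z} {β : Z ⊗ W ⟶ C} {β' : X ⊗ Y ⟶ C} {d : T ⊗ W ⟶ V} {r : V ⟶ Y}
    {d' : D ⊗ W ⟶ B} {l : B ⟶ V} {b : W ⟶ C} {b' : Y ⟶ C}
    (H : γ ▷ W ≫ β = (α_ X T W).hom ≫ X ◁ (d ≫ r) ≫ β')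
    (h : (x ⊗ₘ t) ≫ γ = (λ_ D).hom ≫ s ≫ z) (h₁ : z ▷ W ≫ β = (λ_ W).hom ≫ b)
    (h₂ : x ▷ Y ≫ β' = (λ_ Y).hom ≫ b') (h₃ : t ▷ W ≫ d = d' ≫ l) :
    s ▷ W ≫ (λ_ W).hom ≫ b = d' ≫ (l ≫ r) ≫ b' := by
  -- Restricting associativity to the chosen operations gives the claim preceded by the isomorphism
  -- `(α_ _ _ _).hom ≫ (λ_ _).hom`, which is cancelled at the end.
  have e := congrArg ((x ⊗ₘ t) ▷ W ≫ ·) H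
  simp only [← MonoidalCategory.comp_whiskerRight_assoc, h] at e
  have e' : (x ⊗ₘ t) ▷ W ≫ (α_ X T W).hom ≫ X ◁ (d ≫ r) ≫ β' =
      (α_ _ _ _).hom ≫ (λ_ _).hom ≫ (t ▷ W ≫ d ≫ r) ≫ b' := by
    rw [← tensorHom_id, associator_naturality_assoc, tensorHom_id, MonoidalCategory.tensorHom_def,
      Category.assoc, ← MonoidalCategory.whiskerLeft_comp_assoc, ← whisker_exchange_assoc, h₂,
      leftUnitor_naturality_assoc]
  rw [e', reassoc_of% h₃, MonoidalCategory.comp_whiskerRight,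
    MonoidalCategory.comp_whiskerRight, Category.assoc, Category.assoc, h₁,
    leftUnitor_whiskerRight, Category.assoc] at e
  simpa using e

variable [SymmetricCategory M]

/-- The endomorphism of `W_1 ⊗ ⋯ ⊗ W_n` that inserts tensor factors `I`, shuffles them next to
the `W_i`, and removes them. -/
noncomputable def shuffle {n : ℕ} (W : Fin n → M) : tens W ⟶ tens W :=
  tensPerm ((blocks fun _ : Fin n => 1).symm.trans (Equiv.sigmaUnique (Fin n) fun _ => Fin 1)) W ≫
    insertUnits n _ ≫ distrib (k := fun _ : Fin n => 1) (fun _ => 𝟙_ M) (fun i _ => W i) ≫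
      tensMap (fun i => (λ_ _).hom ≫ tensOne (fun _ => W i))

/-- Each of the four constituents of `shuffle` is natural. This is all that is needed about it:
naturality lets `unary_opAct` move `shuffle` past the unary operations, so its value need not be
determined. -/
theorem shuffle_natural {n : ℕ} {V W : Fin n → M} (f : ∀ i, V i ⟶ W i) :
    tensMap f ≫ shuffle W = shuffle V ≫ tensMap f := by
  have hd := distrib_natural (k := fun _ : Fin n => 1) (fun _ => 𝟙 (𝟙_ M)) (fun i _ => f i)
  rw [tensMap_id, id_tensorHom] at hd
  refine (Category.assoc _ _ _).symm.trans
    (Eq.trans (congrArg (· ≫ _) (tensPerm_natural _ f)) ?_)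
  refine (Category.assoc _ _ _).trans (Eq.trans ?_ (Category.assoc _ _ _).symm)
  refine congrArg (_ ≫ ·) ?_
  refine (Category.assoc _ _ _).symm.trans
    (Eq.trans (congrArg (· ≫ _) (insertUnits_natural _ _)) ?_)
  refine (Category.assoc _ _ _).trans (Eq.trans ?_ (Category.assoc _ _ _).symm)
  refine congrArg (_ ≫ ·) ?_
  refine (Category.assoc _ _ _).symm.trans (Eq.trans (congrArg (· ≫ _) hd) ?_)
  refine (Category.assoc _ _ _).trans (Eq.trans ?_ (Category.assoc _ _ _).symm)
  refine congrArg (_ ≫ ·) ?_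
  refine (tensMap_comp _ _).trans (Eq.trans ?_ (tensMap_comp _ _).symm)
  refine congrArg tensMap (funext fun i => ?_)
  -- A tensor product of length one unfolds to `I ⊗ W i`. The first unitor removes the inserted
  -- factor and the second is `tensOne`.
  change (𝟙 (𝟙_ M) ⊗ₘ 𝟙 (𝟙_ M) ⊗ₘ f i) ≫ (λ_ (𝟙_ M ⊗ W i)).hom ≫ (λ_ (W i)).hom =
    ((λ_ (𝟙_ M ⊗ V i)).hom ≫ (λ_ (V i)).hom) ≫ f i
  simp

variable [MonoidalClosed M] [HasColimits M] {K : Type w}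
  {P : SetOperad.{w, v} K}

/-! ### Algebras over `P ⊗ I` through the operations of `P` -/

namespace OperadAlgebra

/-- The action of an operation `p` of an operad `P` in sets on an algebra over `P ⊗ I`. -/
noncomputable def opAct (A : OperadAlgebra (P.baseChange M)) {t : K} {c : Profile K}
    (p : P.obj c t) : tens (fun i => A.carrier (c.color i)) ⟶ A.carrier t :=
  (λ_ _).inv ≫ copι M p ▷ _ ≫ A.act t c

theorem copι_act (A : OperadAlgebra (P.baseChange M)) {t : K} {c : Profile K} (p : P.obj c t) :
    copι M p ▷ tens (fun i => A.carrier (c.color i)) ≫ A.act t c = (λ_ _).hom ≫ A.opAct p :=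
  (Iso.hom_inv_id_assoc _ _).symm

/-- The defining square of an algebra morphism, restricted along the coprojection of `p`; `homMk` is
the converse. -/
theorem opAct_app {A B : OperadAlgebra (P.baseChange M)} (g : A ⟶ B) {t : K} {c : Profile K}
    (p : P.obj c t) :
    A.opAct p ≫ Hom.app g t = tensMap (fun i => Hom.app g (c.color i)) ≫ B.opAct p := by
  have h := congrArg (copι M p ▷ _ ≫ ·) (Hom.act_app g t c)
  refine (Category.assoc _ _ _).trans (Eq.trans ?_ (leftUnitor_inv_naturality_assoc _ _).symm)
  refine congrArg (_ ≫ ·) ((Category.assoc _ _ _).trans (h.trans ?_))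
  exact (whisker_exchange_assoc _ _ _).symm

/-- A family of morphisms that is compatible with all operations is a morphism of algebras. -/
def homMk {A B : OperadAlgebra (P.baseChange M)} (f : ∀ t, A.carrier t ⟶ B.carrier t)
    (h : ∀ (t : K) (c : Profile K) (p : P.obj c t),
      A.opAct p ≫ f t = tensMap (fun i => f (c.color i)) ≫ B.opAct p) : A ⟶ B where
  app := f
  -- Since the tensor product is closed, the coprojections of `P.obj c t ⊗ I` stay jointly
  -- epimorphic after tensoring with the carriers, so the square may be tested on one operation at a
  -- time.
  act_app t c := (jointEpi_copι (P.obj c t)).whiskerRight _ _ _ fun p => by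
    have h₁ := congrArg (· ≫ f t) (A.copι_act p)
    have h₂ := whisker_exchange_assoc (copι M p) (tensMap fun i => f (c.color i)) (B.act t c)
    rw [copι_act, leftUnitor_naturality_assoc, ← h] at h₂
    exact (Category.assoc _ _ _).symm.trans (h₁.trans ((Category.assoc _ _ _).trans h₂))

/-- Functors to algebras are isomorphic if their components are, compatibly with operations. -/
noncomputable def natIsoMk {𝒜 : Type*} [Category 𝒜] {F G : 𝒜 ⥤ OperadAlgebra (P.baseChange M)}
    (φ : ∀ (A : 𝒜) (t : K), (F.obj A).carrier t ≅ (G.obj A).carrier t)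
    (h : ∀ (A : 𝒜) (t : K) (c : Profile K) (p : P.obj c t), (F.obj A).opAct p ≫ (φ A t).hom =
      tensMap (fun i => (φ A (c.color i)).hom) ≫ (G.obj A).opAct p)
    (hn : ∀ {A B : 𝒜} (g : A ⟶ B) (t : K),
      Hom.app (F.map g) t ≫ (φ B t).hom = (φ A t).hom ≫ Hom.app (G.map g) t) : F ≅ G :=
  NatIso.ofComponents (fun A =>
    { hom := homMk (fun t => (φ A t).hom) (h A)
      -- Compatibility of the inverses with operations is inherited from `h` by cancelling the
      -- isomorphisms, so algebra isomorphisms are componentwise isomorphisms.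
      inv := homMk (fun t => (φ A t).inv) fun t c p => by
        rw [Iso.comp_inv_eq, Category.assoc, h, ← Category.assoc, tensMap_comp]
        simp only [Iso.inv_hom_id, tensMap_id, Category.id_comp]
      hom_inv_id := Hom.ext (funext fun t => (φ A t).hom_inv_id)
      inv_hom_id := Hom.ext (funext fun t => (φ A t).inv_hom_id) })
    fun g => Hom.ext (funext (hn g))

/-- The equivariance axiom evaluated at `p`. It is used for the canonical bijections `concatOne` and
`concatSingle`, which relate a profile to a concatenation of blocks. -/
theorem opAct_map (A : OperadAlgebra (P.baseChange M)) {t : K} {c : Profile K} (p : P.obj c t)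
    {n : ℕ} (σ : Fin n ≃ Fin c.len) :
    tensPerm σ (fun i => A.carrier (c.color i)) ≫ A.opAct (P.map (c.reindexHom σ) p) =
      A.opAct p :=
  opAct_map_aux (A.act_perm t c σ) (copι_copMap _ _)

theorem opAct_one (A : OperadAlgebra (P.baseChange M)) (t : K) :
    A.opAct (P.one t) = tensOne (fun _ => A.carrier t) :=
  (congrArg ((λ_ _).inv ≫ ·) (A.act_one t)).trans (Iso.inv_hom_id_assoc _ _)

/-- The associativity axiom evaluated at `p` and the `q i`. Each inner operation is a morphism out
of `I`, so a factor `I` per block is inserted first, moved next to its block by `distrib`, and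
absorbed by a unitor when the operation acts. -/
theorem opAct_comp (A : OperadAlgebra (P.baseChange M)) {t : K} {a : Profile K}
    (b : Fin a.len → Profile K) (p : P.obj a t) (q : ∀ i, P.obj (b i) (a.color i)) :
    A.opAct (P.comp b p q) = insertUnits a.len _ ≫
      distrib (fun _ => 𝟙_ M) (fun i j => A.carrier ((b i).color j)) ≫
        tensMap (fun i => (λ_ _).hom ≫ A.opAct (q i)) ≫ A.opAct p := by
  refine (Category.id_comp _).symm.trans ?_
  -- The chase in `opAct_comp_aux` yields the identity only after composing with `collapse ▷ _` and
  -- a unitor; `insertUnits` is a section of that morphism.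
  refine (congrArg (· ≫ _) (insertUnits_collapse a.len _)).symm.trans ?_
  refine (Category.assoc _ _ _).trans (congrArg (_ ≫ ·) ?_)
  refine (Category.assoc _ _ _).trans ?_
  refine (opAct_comp_aux (A.act_comp t a b) (copComp_spec _ p q) (A.copι_act _) (A.copι_act _)
    (distrib_whiskerRight (fun i j => A.carrier ((b i).color j)) _)).trans ?_
  refine congrArg (fun f => _ ≫ f ≫ _) ((tensMap_comp _ _).trans ?_)
  exact congrArg tensMap (funext fun i => A.copι_act (q i))

/-- The action of a unary operation. -/
noncomputable def unary (A : OperadAlgebra (P.baseChange M)) {s t : K}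
    (f : P.obj (Profile.single s) t) : A.carrier s ⟶ A.carrier t :=
  (λ_ _).inv ≫ A.opAct f

/-- The carrier `A_s` and its one-fold tensor product `I ⊗ A_s` differ by the left unitor, which is
`tensOne`; this passes between `unary` and `opAct`. -/
theorem tensOne_unary (A : OperadAlgebra (P.baseChange M)) {s t : K}
    (f : P.obj (Profile.single s) t) :
    tensOne (fun _ => A.carrier s) ≫ A.unary f = A.opAct f :=
  Iso.hom_inv_id_assoc _ _

/-- The value that drives the cancellation of canonical morphisms in `opAct_unary` and
`unary_opAct`. -/
theorem unary_one (A : OperadAlgebra (P.baseChange M)) (t : K) : A.unary (P.one t) = 𝟙 _ :=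
  (congrArg ((λ_ _).inv ≫ ·) (A.opAct_one t)).trans (Iso.inv_hom_id _)

theorem unary_app {A B : OperadAlgebra (P.baseChange M)} (g : A ⟶ B) {s t : K}
    (f : P.obj (Profile.single s) t) :
    A.unary f ≫ Hom.app g t = Hom.app g s ≫ B.unary f := by
  refine (Category.assoc _ _ _).trans ((congrArg (_ ≫ ·) (opAct_app g f)).trans ?_)
  refine Eq.trans ?_ (leftUnitor_inv_naturality_assoc _ _).symm
  -- A one-fold `tensMap` is by definition `𝟙 I ⊗ₘ g`, that is, a whiskering.
  exact congrArg (fun h => _ ≫ h ≫ _) (id_tensorHom _ _)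

/-- Applying a unary operation after an operation. -/
theorem opAct_unary (A : OperadAlgebra (P.baseChange M)) {s t : K} {c : Profile K}
    (f : P.obj (Profile.single s) t) (p : P.obj c s) (r : P.obj c t)
    (h : P.comp (a := Profile.single s) (fun _ => c) f (fun _ => p) =
      P.map (Profile.concatOne s c) r) :
    A.opAct p ≫ A.unary f = A.opAct r := by
  -- The composite of `g` with `p` has inputs the one-block concatenation of `c`, hence the
  -- transport along `concatOne`. The point is that the action of `r'` factors as a morphism
  -- independent of `g`, followed by `A.unary g`.
  have key : ∀ {u : K} (g : P.obj (Profile.single s) u) (r' : P.obj c u)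
      (_ : P.comp (a := Profile.single s) (fun _ => c) g (fun _ => p) =
        P.map (Profile.concatOne s c) r'), A.opAct r' =
      (tensPerm (Profile.Hom.perm (Profile.concatOne s c)) (fun i => A.carrier (c.color i)) ≫
        insertUnits 1 _ ≫
        distrib (k := fun _ : Fin 1 => c.len) (fun _ => 𝟙_ M)
          (fun i j => A.carrier (c.color j)) ≫
        tensMap (fun i => (λ_ _).hom ≫ A.opAct p) ≫ tensOne (fun _ => A.carrier s)) ≫
          A.unary g := by
    intro u g r' h'
    refine (A.opAct_map r' (Profile.Hom.perm (Profile.concatOne s c))).symm.trans ?_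
    refine Eq.trans ?_ (Category.assoc _ _ _).symm
    refine congrArg (_ ≫ ·) ?_
    refine (congrArg A.opAct h').symm.trans ?_
    refine Eq.trans ?_ (Category.assoc _ _ _).symm
    refine (A.opAct_comp (a := Profile.single s) _ g _).trans ?_
    refine congrArg (_ ≫ ·) ?_
    refine Eq.trans ?_ (Category.assoc _ _ _).symm
    refine congrArg (_ ≫ ·) ?_
    refine Eq.trans ?_ (Category.assoc _ _ _).symm
    exact congrArg (_ ≫ ·) (A.tensOne_unary g).symm
  -- Taking `g` to be the unit identifies the independent factor with `A.opAct p`, with no coherence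
  -- computation; substituting this in the case `g = f` finishes.
  have h₁ := key (P.one s) p (P.one_comp p)
  rw [unary_one, Category.comp_id] at h₁
  exact (congrArg (· ≫ A.unary f) h₁).trans (key f r h).symm

/-- Equivariance along `concatSingle` followed by `opAct_comp` with blocks of length one. All the
canonical morphisms that appear are collected in `shuffle`, which depends on the input objects only
and not on the operations. -/
theorem opAct_eq_shuffle (A : OperadAlgebra (P.baseChange M)) {t : K} {a : Profile K}
    (x : Fin a.len → K) (f : ∀ i, P.obj (Profile.single (x i)) (a.color i)) (p : P.obj a t)
    (r : P.obj ⟨a.len, x⟩ t)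
    (h : P.comp (fun i => Profile.single (x i)) p f =
      P.map (Profile.concatSingle ⟨a.len, x⟩) r) :
    A.opAct r = shuffle (fun i => A.carrier (x i)) ≫ tensMap (fun i => A.unary (f i)) ≫
      A.opAct p := by
  refine (A.opAct_map r (Profile.Hom.perm (Profile.concatSingle ⟨a.len, x⟩))).symm.trans ?_
  refine Eq.trans ?_ (Category.assoc _ _ _).symm
  refine congrArg (_ ≫ ·) ?_
  refine (congrArg A.opAct h).symm.trans ?_
  refine Eq.trans ?_ (Category.assoc _ _ _).symm
  refine (A.opAct_comp _ p f).trans ?_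
  refine congrArg (_ ≫ ·) ?_
  refine Eq.trans ?_ (Category.assoc _ _ _).symm
  refine congrArg (_ ≫ ·) ?_
  refine Eq.trans ?_ (Category.assoc _ _ _)
  refine congrArg (· ≫ _) ?_
  refine Eq.trans ?_ (tensMap_comp _ _).symm
  refine congrArg tensMap (funext fun i => ?_)
  exact (congrArg (_ ≫ ·) (A.tensOne_unary (f i)).symm).trans (Category.assoc _ _ _).symm

/-- Applying an operation after unary operations. -/
theorem unary_opAct (A : OperadAlgebra (P.baseChange M)) {t : K} {a : Profile K}
    (x : Fin a.len → K) (f : ∀ i, P.obj (Profile.single (x i)) (a.color i)) (p : P.obj a t)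
    (r : P.obj ⟨a.len, x⟩ t)
    (h : P.comp (fun i => Profile.single (x i)) p f =
      P.map (Profile.concatSingle ⟨a.len, x⟩) r) :
    tensMap (fun i => A.unary (f i)) ≫ A.opAct p = A.opAct r := by
  -- With units as inner operations, `shuffle` is seen to be absorbed by `A.opAct p`. By naturality
  -- it can be moved past the unary actions to this place, where it disappears.
  have h₁ := A.opAct_eq_shuffle a.color (fun i => P.one (a.color i)) p p (P.comp_one p)
  simp only [unary_one, tensMap_id, Category.id_comp] at h₁
  rw [A.opAct_eq_shuffle x f p r h]
  refine (congrArg (_ ≫ ·) h₁).trans ?_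
  exact (Category.assoc _ _ _).symm.trans
    ((congrArg (· ≫ _) (shuffle_natural _)).trans (Category.assoc _ _ _))

/-- The base change of `f` sends the coprojection of `p` to that of `f.app p`. -/
theorem opAct_pullback {L : Type*} {Q : SetOperad.{_, v} L} (f : P.Hom Q)
    (B : OperadAlgebra (Q.baseChange M)) {t : K} {c : Profile K} (p : P.obj c t) :
    ((pullback (f.baseChange M)).obj B).opAct p = B.opAct (f.app p) := by
  refine congrArg (_ ≫ ·) ((MonoidalCategory.comp_whiskerRight_assoc _ _ _ _).symm.trans ?_)
  exact congrArg (fun g => g ▷ _ ≫ _) (copι_copMap f.app p)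

end OperadAlgebra

end Elementwise

/-! ### Lifting orthogonal functors along orthogonal equivalences -/

section Orthogonal

theorem Orthogonality.ext {C : Type*} [Category C] {R S : Orthogonality C}
    (h : ∀ ⦃c₁ c₂ c : C⦄ (f₁ : c₁ ⟶ c) (f₂ : c₂ ⟶ c), R.Rel f₁ f₂ ↔ S.Rel f₁ f₂) : R = S := by
  cases R
  cases S
  congr
  funext c₁ c₂ c f₁ f₂
  exact propext (h f₁ f₂)

/-- Naturality writes `G.map f` as `F.map f` conjugated by components of `α`, and orthogonality is
stable under composition on both sides. -/
theorem Orthogonality.rel_of_natIso {C : Type*} [Category C] {D : Type*} [Category D]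
    (S : Orthogonality D) {F G : C ⥤ D} (α : F ≅ G) ⦃c₁ c₂ c : C⦄ {f₁ : c₁ ⟶ c} {f₂ : c₂ ⟶ c}
    (h : S.Rel (F.map f₁) (F.map f₂)) : S.Rel (G.map f₁) (G.map f₂) := by
  rw [← NatIso.naturality_1 α f₁, ← NatIso.naturality_1 α f₂]
  exact S.precomp _ _ (S.postcomp _ h)

namespace OrthFunctor

variable {C : Type*} [Category C] {D : Type*} [Category D] {E : Type*} [Category E]
  {R : Orthogonality C} {S : Orthogonality D} {T : Orthogonality E}

/-- The identity orthogonal functor. -/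
def id (R : Orthogonality C) : OrthFunctor R R := ⟨𝟭 C, fun _ _ _ _ _ h => h⟩

/-- The composition of orthogonal functors. -/
def comp (F : OrthFunctor R S) (G : OrthFunctor S T) : OrthFunctor R T :=
  ⟨F.functor ⋙ G.functor, fun _ _ _ _ _ h => G.map_rel (F.map_rel h)⟩

/-- The condition `F^*(⊥_D) = ⊥_C` in pointwise form. The forward implication, reflection of
orthogonality, is what makes quasi-inverses orthogonal. -/
theorem IsOrthEquivalence.rel_iff {F : OrthFunctor R S} (hF : F.IsOrthEquivalence)
    ⦃c₁ c₂ c : C⦄ {f₁ : c₁ ⟶ c} {f₂ : c₂ ⟶ c} :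
    S.Rel (F.functor.map f₁) (F.functor.map f₂) ↔ R.Rel f₁ f₂ :=
  iff_of_eq (congrArg (fun Q : Orthogonality C => Q.Rel f₁ f₂) hF.pullback_eq)

variable (I : OrthFunctor R T) (J : OrthFunctor S T) (hJ : J.IsOrthEquivalence)

/-- The isomorphism `J ∘ J⁻¹ ∘ I ≅ I`. -/
noncomputable def liftIso [J.functor.IsEquivalence] :
    (I.functor ⋙ J.functor.inv) ⋙ J.functor ≅ I.functor :=
  Functor.isoWhiskerLeft I.functor J.functor.asEquivalence.counitIso

/-- The lift `J⁻¹ ∘ I` of an orthogonal functor along an orthogonal equivalence. -/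
noncomputable def lift : OrthFunctor R S where
  functor := have := hJ.isEquivalence; I.functor ⋙ J.functor.inv
  map_rel _ _ _ _ _ h := by
    have := hJ.isEquivalence
    -- Since `J` reflects orthogonality, it suffices to check the pair after applying `J`, where the
    -- lift becomes isomorphic to `I`.
    exact hJ.rel_iff.1 (T.rel_of_natIso (liftIso I J).symm (I.map_rel h))

theorem nonempty_lift_comp_iso : Nonempty ((lift I J hJ).functor ⋙ J.functor ≅ I.functor) :=
  have := hJ.isEquivalence
  ⟨liftIso I J⟩

theorem isOrthEquivalence_lift (hI : I.IsOrthEquivalence) :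
    (lift I J hJ).IsOrthEquivalence where
  isEquivalence := by
    have := hI.isEquivalence
    have := hJ.isEquivalence
    exact inferInstanceAs (I.functor ⋙ J.functor.inv).IsEquivalence
  pullback_eq := by
    obtain ⟨e⟩ := nonempty_lift_comp_iso I J hJ
    exact Orthogonality.ext fun _ _ _ f₁ f₂ =>
      -- The lift reflects orthogonality because `J` preserves it, `J ∘ J⁻¹ ∘ I` is isomorphic to
      -- `I`, and `I` reflects it.
      ⟨fun h => hI.rel_iff.1 (T.rel_of_natIso e (J.map_rel h)), fun h => (lift I J hJ).map_rel h⟩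

end OrthFunctor

end Orthogonal

/-! ### Pseudofunctoriality of the pullback of quantum field theories -/

section Pullback

open OperadAlgebra

/-- A morphism as a unary operation. -/
def FreeOp.ofHom {C : Type u} [Category.{v} C] {s t : C} (f : s ⟶ t) :
    FreeOp C (Profile.single s) t where
  perm := Equiv.refl _
  hom _ := f

variable (M : Type u) [Category.{v} M] [MonoidalCategory M] [SymmetricCategory M]
  [MonoidalClosed M] [HasColimits M] {C : Type w} [Category.{v} C] {D : Type w} [Category.{v} D]
  {E : Type w} [Category.{v} E] {R : Orthogonality C} {S : Orthogonality D} {T : Orthogonality E}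

variable {M} in
-- Operadic composition with `[e, f]` on the outside leaves the permutation alone and postcomposes
-- every morphism with `f`. This holds already before passing to the quotient by `∼_⊥`.
theorem opAct_unary_ofHom (A : QFT M R) {c : Profile C} {s t : C} (p : FreeOp C c s)
    (f : s ⟶ t) : opAct A (OrthOp.mk R p) ≫ unary A (OrthOp.mk R (FreeOp.ofHom f)) =
      opAct A (OrthOp.mk R ⟨p.perm, fun i => p.hom i ≫ f⟩) := by
  refine opAct_unary A _ _ _ ?_
  refine (OrthOp.comp_mk (a := Profile.single s) (fun _ => c) _ _).trans
    (Eq.trans ?_ (OrthOp.map_mk _ _).symm)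
  refine congrArg _ (FreeOp.ext' (fun i j h => ?_) (fun i => ?_))
  · have h2 := (FreeOp.comp_lt (a := Profile.single s) (fun _ => c) _ _ _ _ _ _ rfl rfl).1 h
    rcases h2 with h2 | h2
    · exact absurd h2 (fin_one_not_lt _ _)
    · exact h2.2
  · exact (Category.id_comp _).symm

variable {M} in
-- The counterpart on the inside: composing with `[e, f_i]` in each input precomposes the morphisms
-- and keeps the permutation.
theorem unary_ofHom_opAct (A : QFT M R) {c : Profile C} {t : C} (x : Fin c.len → C)
    (f : ∀ i, x i ⟶ c.color i) (p : FreeOp C c t) :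
    tensMap (fun i => unary A (OrthOp.mk R (FreeOp.ofHom (f i)))) ≫ opAct A (OrthOp.mk R p) =
      opAct (c := ⟨c.len, x⟩) A (OrthOp.mk R ⟨p.perm, fun i => f i ≫ p.hom i⟩) := by
  refine unary_opAct A x _ _ _ ?_
  refine (OrthOp.comp_mk _ _ _).trans (Eq.trans ?_ (OrthOp.map_mk _ _).symm)
  refine congrArg _ (FreeOp.ext' (fun i j h => ?_) (fun i => ?_))
  -- All blocks have length one, so the order of two entries is decided between blocks, by `p`.
  · have h2 := (FreeOp.comp_lt _ _ _ _ _ _ _ rfl rfl).1 h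
    rcases h2 with h2 | h2
    · exact h2
    · exact absurd h2.2 (fin_one_not_lt _ _)
  · exact (Category.id_comp _).symm

variable {M} in
-- With `unary_ofHom_id`, this says that a quantum field theory has an underlying functor `C ⥤ M`;
-- hence isomorphisms of `C` act invertibly.
theorem unary_ofHom_comp (A : QFT M R) {r s t : C} (f : r ⟶ s) (g : s ⟶ t) :
    unary A (OrthOp.mk R (FreeOp.ofHom f)) ≫ unary A (OrthOp.mk R (FreeOp.ofHom g)) =
      unary A (OrthOp.mk R (FreeOp.ofHom (f ≫ g))) :=
  (Category.assoc _ _ _).trans (congrArg (_ ≫ ·) (opAct_unary_ofHom A (FreeOp.ofHom f) g))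

variable {M} in
theorem unary_ofHom_id (A : QFT M R) (t : C) :
    unary A (OrthOp.mk R (FreeOp.ofHom (𝟙 t))) = 𝟙 _ :=
  unary_one A t

variable {M} in
/-- The action of an isomorphism. -/
noncomputable def unaryIso (A : QFT M R) {s t : C} (e : s ≅ t) :
    A.carrier s ≅ A.carrier t where
  hom := unary A (OrthOp.mk R (FreeOp.ofHom e.hom))
  inv := unary A (OrthOp.mk R (FreeOp.ofHom e.inv))
  hom_inv_id := by rw [unary_ofHom_comp, e.hom_inv_id, unary_ofHom_id]
  inv_hom_id := by rw [unary_ofHom_comp, e.inv_hom_id, unary_ofHom_id]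

variable {M} in
theorem opAct_qftPullback (F : OrthFunctor R S) (B : QFT M S) {c : Profile C} {t : C}
    (p : FreeOp C c t) : opAct ((qftPullback M F).obj B) (OrthOp.mk R p) =
      opAct B (OrthOp.mk S (p.mapFunctor F.functor)) :=
  (opAct_pullback (orthOperadHom F) B _).trans (congrArg (opAct B) (OrthOp.mapFunctor_mk F p))

/-- Naturally isomorphic orthogonal functors have isomorphic pullback functors. -/
noncomputable def qftPullbackIso {F G : OrthFunctor R S} (α : F.functor ≅ G.functor) :
    qftPullback M F ≅ qftPullback M G :=
  natIsoMk (fun B t => unaryIso B (α.app t)) (fun B t c p => by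
    obtain ⟨p, rfl⟩ := OrthOp.exists_rep p
    refine (congrArg (· ≫ _) (opAct_qftPullback F B p)).trans
      (Eq.trans ?_ (congrArg (_ ≫ ·) (opAct_qftPullback G B p).symm))
    -- Both sides become the action of one operation with the permutation of `p`: its morphisms are
    -- `F f_i ≫ α_t` on one side and `α_{c_i} ≫ G f_i` on the other, equal by naturality of `α`.
    -- Naturality in `B` is `unary_app`.
    refine (opAct_unary_ofHom B (p.mapFunctor F.functor) (α.hom.app t)).trans
      (Eq.trans ?_ (unary_ofHom_opAct B (fun i => F.functor.obj (c.color i))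
        (fun i => α.hom.app (c.color i)) (p.mapFunctor G.functor)).symm)
    refine congrArg (fun q => opAct B (OrthOp.mk S q)) (FreeOp.ext rfl (funext fun i => ?_))
    exact α.hom.naturality (p.hom i)) fun g t => (unary_app g _).symm

/-- The pullback along the identity is the identity. -/
noncomputable def qftPullbackId (R : Orthogonality C) :
    qftPullback M (OrthFunctor.id R) ≅ 𝟭 (QFT M R) :=
  -- The carriers agree on the nose. The actions are compared on representatives, because
  -- `OrthOp.mapFunctor` is defined through a choice of representative.
  natIsoMk (fun A t => Iso.refl (A.carrier t)) (fun A t c p => by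
    obtain ⟨p, rfl⟩ := OrthOp.exists_rep p
    refine (Category.comp_id _).trans ((opAct_qftPullback _ A p).trans ?_)
    exact (Category.id_comp _).symm.trans (congrArg (· ≫ opAct A _) (tensMap_id _).symm))
    fun g t => (Category.comp_id _).trans (Category.id_comp _).symm

/-- The pullback along a composition is the composition of the pullbacks. -/
noncomputable def qftPullbackComp (F : OrthFunctor R S) (G : OrthFunctor S T) :
    qftPullback M (F.comp G) ≅ qftPullback M G ⋙ qftPullback M F :=
  natIsoMk (fun A t => Iso.refl (A.carrier (G.functor.obj (F.functor.obj t))))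
    (fun A t c p => by
      obtain ⟨p, rfl⟩ := OrthOp.exists_rep p
      refine (Category.comp_id _).trans ((opAct_qftPullback _ A p).trans ?_)
      refine Eq.trans ?_ ((Category.id_comp _).symm.trans (congrArg (· ≫ _) (tensMap_id _).symm))
      exact ((opAct_qftPullback F _ p).trans
        (opAct_qftPullback G A (p.mapFunctor F.functor))).symm)
    fun g t => (Category.comp_id _).trans (Category.id_comp _).symm

/-- The pullback functor along an orthogonal equivalence is an equivalence. -/
theorem isEquivalence_qftPullback (F : OrthFunctor R S) (hF : F.IsOrthEquivalence) :
    (qftPullback M F).IsEquivalence := by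
  -- Lifting the identity along `F` gives an orthogonal quasi-inverse `G`, with `ε : G ⋙ F ≅ 𝟭 D`.
  obtain ⟨ε⟩ := OrthFunctor.nonempty_lift_comp_iso (OrthFunctor.id S) F hF
  let G := OrthFunctor.lift (OrthFunctor.id S) F hF
  have := hF.isEquivalence
  -- The other isomorphism comes from `F ⋙ G ⋙ F ≅ F` by cancelling the fully faithful `F`.
  have η : F.functor ⋙ G.functor ≅ 𝟭 C :=
    Functor.fullyFaithfulCancelRight F.functor (Functor.isoWhiskerLeft F.functor ε)
  -- Pullback reverses composition, so `ε` gives the unit and `η` the counit. No triangle identity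
  -- has to be checked, since any such pair of isomorphisms can be corrected to an adjoint
  -- equivalence.
  exact (CategoryTheory.Equivalence.mk (qftPullback M F) (qftPullback M G)
    ((qftPullbackId M S).symm ≪≫ qftPullbackIso M (F := OrthFunctor.id S) (G := G.comp F) ε.symm ≪≫
      qftPullbackComp M G F)
    ((qftPullbackComp M F G).symm ≪≫
      qftPullbackIso M (F := F.comp G) (G := OrthFunctor.id R) η ≪≫
      qftPullbackId M R)).isEquivalence_functor

end Pullback

end OrthQFT

/-! ### Morita equivalence and independence of the small model -/

theorem theorem5p9
    (M : Type u) [Category.{v} M] [MonoidalCategory M] [SymmetricCategory M] [MonoidalClosed M]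
    [HasLimits M] [HasColimits M] :
    (∀ (C D : Type v) [Category.{v} C] [Category.{v} D] (R : Orthogonality C) (S : Orthogonality D)
      (F : OrthFunctor R S), F.IsOrthEquivalence →
      (qftPullback M F).IsRightAdjoint ∧
        ∀ (L : QFT M R ⥤ QFT M S) (adj : L ⊣ qftPullback M F),
          IsIso adj.unit ∧ IsIso adj.counit) ∧
    (∀ (E : Type w) [Category.{w'} E] (T : Orthogonality E)
      (C D : Type v) [Category.{v} C] [Category.{v} D] (R : Orthogonality C) (S : Orthogonality D)
      (I : OrthFunctor R T) (J : OrthFunctor S T), I.IsOrthEquivalence → J.IsOrthEquivalence →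
      ∃ G : OrthFunctor R S, G.IsOrthEquivalence ∧
        Nonempty (G.functor ⋙ J.functor ≅ I.functor) ∧ (qftPullback M G).IsEquivalence) := by
  refine ⟨fun C D _ _ R S F hF => ?_, fun E _ T C D _ _ R S I J hI hJ => ?_⟩
  · have := isEquivalence_qftPullback M F hF
    exact ⟨inferInstance, fun L adj =>
      -- Both functors of the adjunction are now equivalences, in particular fully faithful; a fully
      -- faithful left adjoint has invertible unit and a fully faithful right adjoint has invertible
      -- counit.
      have := adj.isEquivalence_left_of_isEquivalence_right
      ⟨inferInstance, inferInstance⟩⟩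
  -- The functor `G` is `J⁻¹ ∘ I`. The large category `E` enters only through it: `G` itself runs
  -- between small categories, so the equivalence result for pullbacks applies to it.
  · have hG := OrthFunctor.isOrthEquivalence_lift I J hJ hI
    exact ⟨OrthFunctor.lift I J hJ, hG, OrthFunctor.nonempty_lift_comp_iso I J hJ,
      isEquivalence_qftPullback M _ hG⟩
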